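/- Let $n,d,p\ge 1$ be integers with $p\le d$, let $w\in\mathbb{R}^d$ and $\sigma>0$. Let $x\sim\mathcal N(0,I_d)$ and $\varepsilon\sim\mathcal N(0,1)$ be independent, and put $y=x^{T}w+\sigma\varepsilon$. Let $(X_i,Y_i)_{i=1}^n$ be i.i.d. copies of $(x,y)$, independent of $(x,y)$; let $\mathbf X\in\mathbb{R}^{n\times d}$ be the matrix with rows $X_i^{T}$ and $\mathbf Y=(Y_1,\dots,Y_n)^{T}$. Fix any subset $T\subseteq\{1,\dots,d\}$ with $|T|=p$. Let $\mathbf X_T\in\mathbb{R}^{n\times p}$ be the submatrix of $\mathbf X$ formed by the columns with index in $T$, and let $w_p=(w_j)_{j\in T}$ and $w_q=(w_j)_{j\notin T}$ (so $w_q$ has $q=d-p$ coordinates). Let $\hat w\in\mathbb{R}^d$ be the vector whose coordinates in $T$ are those of $\mathbf X_T^{+}\mathbf Y$, where $\mathbf X_T^{+}$ is the Moore–Penrose pseudo-inverse (so that $\mathbf X_T^{+}\mathbf Y$ is the minimum-norm least-squares solution), and whose coordinates outside $T$ are $0$. Then the risk of $\hat w$, the expectation being over the training sample and the test pair $(x,y)$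 and taken in $[0,+\infty]$, is $$ \mathbb{E}\big[(y-x^{T}\hat w)^2\big]= \begin{cases} (\|w_q\|^2+\sigma^2)\left(1+\dfrac{p}{n-p-1}\right) & \text{if } p\le n-2,\\[2mm] +\infty & \text{if } n-1\le p\le n+1,\\[1mm] \|w_p\|^2\left(1-\dfrac np\right)+(\|w_q\|^2+\sigma^2)\left(1+\dfrac{n}{p-n-1}\right) & \text{if } p\ge n+2, \end{cases} $$ where $\|\cdot\|$ is the Euclidean norm. -/

import Mathlib

open MeasureTheory ProbabilityTheory
open scoped ENNReal Matrix RealInnerProductSpace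

namespace DoubleDescent

/-- The four Penrose equations: `B` is the Moore-Penrose pseudo-inverse of the real matrix `A`. -/
structure IsMoorePenroseInverse {m k : Type*} [Fintype m] [Fintype k]
    (A : Matrix m k ℝ) (B : Matrix k m ℝ) : Prop where
  mul_mul_left : A * B * A = A
  mul_mul_right : B * A * B = B
  left_symm : (A * B)ᵀ = A * B
  right_symm : (B * A)ᵀ = B * A

theorem IsMoorePenroseInverse.unique {m k : Type*} [Fintype m] [Fintype k]
    {A : Matrix m k ℝ} {B C : Matrix k m ℝ}
    (hB : IsMoorePenroseInverse A B) (hC : IsMoorePenroseInverse A C) : B = C := by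
  have h1 : A * B = A * C := by
    have e : A * C * (A * B) = A * B := by
      rw [← Matrix.mul_assoc, hC.mul_mul_left]
    have e2 := congrArg Matrix.transpose e
    rw [Matrix.transpose_mul, hB.left_symm, hC.left_symm, ← Matrix.mul_assoc,
      hB.mul_mul_left] at e2
    exact e2.symm
  have h2 : B * A = C * A := by
    have e : B * A * (C * A) = B * A := by
      rw [Matrix.mul_assoc, ← Matrix.mul_assoc A, hC.mul_mul_left]
    have e2 := congrArg Matrix.transpose e
    rw [Matrix.transpose_mul, hB.right_symm, hC.right_symm, Matrix.mul_assoc,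
      ← Matrix.mul_assoc A, hB.mul_mul_left] at e2
    exact e2.symm
  calc B = B * A * B := hB.mul_mul_right.symm
    _ = C * (A * B) := by rw [h2, Matrix.mul_assoc]
    _ = C * A * C := by rw [h1, Matrix.mul_assoc]
    _ = C := hC.mul_mul_right

theorem exists_isMoorePenroseInverse {m k : Type*} [Fintype m] [Fintype k]
    (A : Matrix m k ℝ) : ∃ B : Matrix k m ℝ, IsMoorePenroseInverse A B := by
  classical
  -- a symmetric generalized inverse `N` of the Gram matrix, from its diagonalization
  obtain ⟨N, hNs, h1, h2, h3⟩ : ∃ N : Matrix k k ℝ, Nᵀ = N ∧ (Aᵀ * A) * N * (Aᵀ * A) = Aᵀ * A ∧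
      N * (Aᵀ * A) * N = N ∧ (N * (Aᵀ * A))ᵀ = N * (Aᵀ * A) := by
    have hM : (Aᵀ * A).IsHermitian := by
      simpa [Matrix.conjTranspose_eq_transpose_of_trivial] using
        Matrix.isHermitian_conjTranspose_mul_self A
    set U : Matrix k k ℝ := (hM.eigenvectorUnitary : Matrix k k ℝ) with hU
    have hUU : Uᵀ * U = 1 := by
      have := Unitary.coe_star_mul_self hM.eigenvectorUnitary
      simpa [Matrix.star_eq_conjTranspose, Matrix.conjTranspose_eq_transpose_of_trivial] using this
    set l : k → ℝ := hM.eigenvalues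
    have hS : Aᵀ * A = U * Matrix.diagonal l * Uᵀ := by
      have := hM.spectral_theorem
      rw [Unitary.conjStarAlgAut_apply] at this
      simpa [Matrix.star_eq_conjTranspose, Matrix.conjTranspose_eq_transpose_of_trivial,
        Function.comp_def] using this
    have key : ∀ a b : k → ℝ, (U * Matrix.diagonal a * Uᵀ) * (U * Matrix.diagonal b * Uᵀ) =
        U * Matrix.diagonal (fun i => a i * b i) * Uᵀ := by
      intro a b
      calc _ = U * Matrix.diagonal a * (Uᵀ * U) * Matrix.diagonal b * Uᵀ := by
            simp only [Matrix.mul_assoc]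
        _ = _ := by rw [hUU, Matrix.mul_one, Matrix.mul_assoc U, Matrix.diagonal_mul_diagonal]
    have keyT : ∀ a : k → ℝ, (U * Matrix.diagonal a * Uᵀ)ᵀ = U * Matrix.diagonal a * Uᵀ := by
      intro a
      simp [Matrix.transpose_mul, Matrix.mul_assoc]
    refine ⟨U * Matrix.diagonal (fun i => (l i)⁻¹) * Uᵀ, keyT _, ?_, ?_, ?_⟩
    · rw [hS, key, key]
      congr 3
      funext i
      by_cases h : l i = 0 <;> simp [h]
    · rw [hS, key, key]
      congr 3
      funext i
      by_cases h : l i = 0 <;> simp [h]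
    · rw [hS, key, keyT]
  have hA : A * (N * (Aᵀ * A)) = A := by
    have h0 : (A * (N * (Aᵀ * A)) - A)ᵀ * (A * (N * (Aᵀ * A)) - A) = 0 := by
      have e : A * (N * (Aᵀ * A)) - A = A * (N * (Aᵀ * A) - 1) := by
        rw [Matrix.mul_sub, Matrix.mul_one]
      rw [e, Matrix.transpose_mul, Matrix.mul_assoc, ← Matrix.mul_assoc Aᵀ, Matrix.mul_sub,
        ← Matrix.mul_assoc (Aᵀ * A), h1, Matrix.mul_one, sub_self, Matrix.mul_zero]
    rw [← Matrix.conjTranspose_eq_transpose_of_trivial] at h0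
    exact sub_eq_zero.mp (Matrix.conjTranspose_mul_self_eq_zero.mp h0)
  refine ⟨N * Aᵀ, ?_, ?_, ?_, ?_⟩
  · simpa only [Matrix.mul_assoc] using hA
  · calc N * Aᵀ * A * (N * Aᵀ) = N * (Aᵀ * A) * N * Aᵀ := by simp only [Matrix.mul_assoc]
      _ = N * Aᵀ := by rw [h2]
  · simp [Matrix.transpose_mul, hNs, Matrix.mul_assoc]
  · simpa only [Matrix.mul_assoc] using h3

/-- The Moore-Penrose pseudo-inverse `A⁺` of a real matrix: the unique solution of the four
Penrose equations. -/
noncomputable def pinv {m k : Type*} [Fintype m] [Fintype k] (A : Matrix m k ℝ) : Matrix k m ℝ :=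
  Classical.choose (exists_isMoorePenroseInverse A)

theorem isMoorePenroseInverse_pinv {m k : Type*} [Fintype m] [Fintype k] (A : Matrix m k ℝ) :
    IsMoorePenroseInverse A (pinv A) :=
  Classical.choose_spec (exists_isMoorePenroseInverse A)

/-- The matrix whose rows are the given sample points. -/
def designMatrix {n d : ℕ} (X : Fin n → EuclideanSpace ℝ (Fin d)) : Matrix (Fin n) (Fin d) ℝ :=
  Matrix.of fun i j => X i j

/-- The sub-matrix of the columns with index in `T`. -/
def subMatrix {n d : ℕ} (A : Matrix (Fin n) (Fin d) ℝ) (T : Finset (Fin d)) :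
    Matrix (Fin n) T ℝ :=
  A.submatrix id (fun j : T => (j : Fin d))

/-- The sub-vector of the coordinates with index in `T`. -/
noncomputable def subVector {d : ℕ} (w : EuclideanSpace ℝ (Fin d)) (T : Finset (Fin d)) :
    EuclideanSpace ℝ T :=
  WithLp.toLp 2 fun j : T => w j

/-- The vector of `ℝ^d` whose coordinates with index in `T` are those of `u`, and whose
coordinates with index outside `T` are those of `v`. -/
noncomputable def rearrange {d : ℕ} (T : Finset (Fin d)) (u : EuclideanSpace ℝ T)
    (v : EuclideanSpace ℝ (Tᶜ : Finset (Fin d))) : EuclideanSpace ℝ (Fin d) :=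
  WithLp.toLp 2 fun j =>
    if h : j ∈ T then u ⟨j, h⟩ else v ⟨j, Finset.mem_compl.mpr h⟩

/-- The estimator: the pseudo-inverse solution `X_T⁺ Y` on the coordinates in `T`, and zero on the
other coordinates. -/
noncomputable def estimator {n d : ℕ} (T : Finset (Fin d))
    (X : Fin n → EuclideanSpace ℝ (Fin d)) (Y : Fin n → ℝ) : EuclideanSpace ℝ (Fin d) :=
  rearrange T (WithLp.toLp 2 (pinv (subMatrix (designMatrix X) T) *ᵥ Y)) 0

end DoubleDescent

set_option linter.unusedSectionVars false
-- Given the training sample, the test error has mean `‖w - ŵ‖² + σ²`, so everything reduces to the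
-- law of the estimator. Let `A` be the `n × p` matrix of the selected columns. Then `Y = A w_p +
-- η`, where the noise `η` collects the unselected coordinates and `σ ε`. Disjoint blocks of a
-- Gaussian vector are independent, so `η` is independent of `A` and has i.i.d. entries of variance
-- `s = ‖w_q‖² + σ²` (`map_prod_linearModel`, `measurePreserving_sample`).
--
-- Since `A⁺A` is the orthogonal projection onto the row span and `A⁺η` lies in that span,
-- Pythagoras gives (`lintegral_estimation_error`) risk = E dist(w_p, row span)² + s · E‖A⁺‖²_F + s.
--
-- The first term vanishes for `p ≤ n`, since `A⁺A = 1` almost surely. For `p ≥ n`, rotation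
-- invariance and a trace give `‖w_p‖² (1 - n/p)` (`card_mul_lintegral_residSq`).
--
-- For the second term with `n ≤ p`, the columns of `A⁺` form the basis dual to the rows, so the
-- norm of column `j` is the inverse of the distance from row `j` to the span of the others. That
-- squared distance is chi-squared with `ν = p + 1 - n` degrees of freedom, and `E[1/χ²_ν]` is `1/(ν
-- - 2)` for `ν ≥ 3` and infinite otherwise (`lintegral_pinvNormSq`). Transposing `A` exchanges `n`
-- and `p`. The infinite range is exactly `ν ≤ 2`.
namespace DoubleDescent

/-! ### Uniqueness, transposition and measurability of the pseudo-inverse. -/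

section PseudoInverse

variable {m k : Type*} [Fintype m] [Fintype k]

theorem IsMoorePenroseInverse.pinv_eq {A : Matrix m k ℝ} {B : Matrix k m ℝ}
    (h : IsMoorePenroseInverse A B) : pinv A = B :=
  (isMoorePenroseInverse_pinv A).unique h

theorem pinv_transpose (A : Matrix m k ℝ) : pinv Aᵀ = (pinv A)ᵀ := by
  have h := isMoorePenroseInverse_pinv A
  apply IsMoorePenroseInverse.pinv_eq
  constructor
  · rw [← Matrix.transpose_mul, ← Matrix.transpose_mul, ← Matrix.mul_assoc, h.mul_mul_left]
  · rw [← Matrix.transpose_mul, ← Matrix.transpose_mul, ← Matrix.mul_assoc, h.mul_mul_right]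
  · rw [← Matrix.transpose_mul, h.right_symm, h.right_symm]
  · rw [← Matrix.transpose_mul, h.left_symm, h.left_symm]

/-- The pseudo-inverse is not continuous, but its graph is closed, being cut out by the polynomial
Penrose equations. The first projection is injective on the graph, and injective measurable images
of Borel sets are Borel (Lusin–Souslin). -/
theorem measurable_pinv :
    Measurable (fun (A : m → k → ℝ) j i => pinv (Matrix.of A) j i) := by
  set G : Set ((m → k → ℝ) × (k → m → ℝ)) :=
    {q | IsMoorePenroseInverse (Matrix.of q.1) (Matrix.of q.2)} with hG
  have hGc : IsClosed G := by
    have c1 : Continuous fun q : (m → k → ℝ) × (k → m → ℝ) => (Matrix.of q.1 : Matrix m k ℝ) :=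
      continuous_fst
    have c2 : Continuous fun q : (m → k → ℝ) × (k → m → ℝ) => (Matrix.of q.2 : Matrix k m ℝ) :=
      continuous_snd
    have : G = {q | Matrix.of q.1 * Matrix.of q.2 * Matrix.of q.1 = Matrix.of q.1} ∩
        {q | Matrix.of q.2 * Matrix.of q.1 * Matrix.of q.2 = Matrix.of q.2} ∩
        {q | (Matrix.of q.1 * Matrix.of q.2)ᵀ = Matrix.of q.1 * Matrix.of q.2} ∩
        {q | (Matrix.of q.2 * Matrix.of q.1)ᵀ = Matrix.of q.2 * Matrix.of q.1} := by
      ext q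
      exact ⟨fun h => ⟨⟨⟨h.1, h.2⟩, h.3⟩, h.4⟩, fun h => ⟨h.1.1.1, h.1.1.2, h.1.2, h.2⟩⟩
    rw [this]
    refine ((IsClosed.inter ?_ ?_).inter ?_).inter ?_
    · exact isClosed_eq ((c1.matrix_mul c2).matrix_mul c1) c1
    · exact isClosed_eq ((c2.matrix_mul c1).matrix_mul c2) c2
    · exact isClosed_eq (c1.matrix_mul c2).matrix_transpose (c1.matrix_mul c2)
    · exact isClosed_eq (c2.matrix_mul c1).matrix_transpose (c2.matrix_mul c1)
  intro s hs
  have : (fun (A : m → k → ℝ) j i => pinv (Matrix.of A) j i) ⁻¹' s =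
      Prod.fst '' (G ∩ Prod.snd ⁻¹' s) := by
    ext A
    constructor
    · intro h
      exact ⟨(A, pinv (Matrix.of A)), ⟨isMoorePenroseInverse_pinv (Matrix.of A), h⟩, rfl⟩
    · rintro ⟨⟨A', B⟩, ⟨h1, h2⟩, rfl⟩
      have : pinv (Matrix.of A') = Matrix.of B := IsMoorePenroseInverse.pinv_eq h1
      change (fun j i => pinv (Matrix.of A') j i) ∈ s
      rw [this]
      exact h2
  rw [this]
  apply MeasurableSet.image_of_measurable_injOn (hGc.measurableSet.inter (measurable_snd hs))
    measurable_fst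
  rintro ⟨A, B⟩ ⟨h1, -⟩ ⟨A', B'⟩ ⟨h2, -⟩ (rfl : A = A')
  have : Matrix.of B = Matrix.of B' := IsMoorePenroseInverse.unique h1 h2
  exact Prod.ext rfl this

end PseudoInverse

/-! ### Geometry of the pseudo-inverse: row span, residual, dual basis. -/

section Rows

variable {ι κ : Type*} [Fintype ι] [Fintype κ]

/-- The matrix with the given rows. -/
def rowMatrix (A : ι → EuclideanSpace ℝ κ) : Matrix ι κ ℝ := Matrix.of fun i j => A i j

/-- The span of the rows. -/
def rowSpan (A : ι → EuclideanSpace ℝ κ) : Submodule ℝ (EuclideanSpace ℝ κ) :=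
  Submodule.span ℝ (Set.range A)

/-- The columns of the pseudo-inverse. -/
noncomputable def pinvCol (A : ι → EuclideanSpace ℝ κ) (i : ι) : EuclideanSpace ℝ κ :=
  WithLp.toLp 2 fun j => pinv (rowMatrix A) j i

/-- The squared Frobenius norm of the pseudo-inverse. -/
noncomputable def pinvNormSq (A : ι → EuclideanSpace ℝ κ) : ℝ := ∑ i, ‖pinvCol A i‖ ^ 2

theorem rowMatrix_mulVec (A : ι → EuclideanSpace ℝ κ) (v : EuclideanSpace ℝ κ) :
    rowMatrix A *ᵥ v.ofLp = fun i => ⟪A i, v⟫ := by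
  funext i
  simp [Matrix.mulVec, dotProduct, rowMatrix, PiLp.inner_apply, mul_comm]

theorem toLp_transpose_mulVec_mem (A : ι → EuclideanSpace ℝ κ) (u : ι → ℝ) :
    WithLp.toLp 2 ((rowMatrix A)ᵀ *ᵥ u) ∈ rowSpan A := by
  have : WithLp.toLp 2 ((rowMatrix A)ᵀ *ᵥ u) = ∑ i, u i • A i := by
    ext j
    simp [Matrix.mulVec, dotProduct, rowMatrix, mul_comm]
  rw [this]
  exact Submodule.sum_mem _ fun i _ => Submodule.smul_mem _ _ (Submodule.subset_span ⟨i, rfl⟩)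

theorem pinv_mulVec_mem (A : ι → EuclideanSpace ℝ κ) (u : ι → ℝ) :
    WithLp.toLp 2 (pinv (rowMatrix A) *ᵥ u) ∈ rowSpan A := by
  have h := isMoorePenroseInverse_pinv (rowMatrix A)
  -- With `B = A⁺`: `B = (BA)B = (BA)ᵀB = AᵀBᵀB`.
  have e : pinv (rowMatrix A) *ᵥ u =
      (rowMatrix A)ᵀ *ᵥ ((pinv (rowMatrix A))ᵀ *ᵥ (pinv (rowMatrix A) *ᵥ u)) := by
    rw [Matrix.mulVec_mulVec, ← Matrix.transpose_mul, h.right_symm, Matrix.mulVec_mulVec,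
      h.mul_mul_right]
  rw [e]
  exact toLp_transpose_mulVec_mem A _

theorem pinvCol_mem [DecidableEq ι] (A : ι → EuclideanSpace ℝ κ) (i : ι) :
    pinvCol A i ∈ rowSpan A := by
  have := pinv_mulVec_mem A (Pi.single i 1)
  rwa [Matrix.mulVec_single_one] at this

theorem mem_orthogonal_rowSpan {A : ι → EuclideanSpace ℝ κ} {v : EuclideanSpace ℝ κ} :
    v ∈ (rowSpan A)ᗮ ↔ ∀ i, ⟪A i, v⟫ = 0 := by
  rw [Submodule.mem_orthogonal]
  refine ⟨fun h i => h _ (Submodule.subset_span ⟨i, rfl⟩), fun h u hu => ?_⟩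
  induction hu using Submodule.span_induction with
  | mem x hx => obtain ⟨i, rfl⟩ := hx; exact h i
  | zero => simp
  | add x y _ _ hx hy => rw [inner_add_left, hx, hy, add_zero]
  | smul a x _ hx => rw [real_inner_smul_left, hx, mul_zero]

/-- `A⁺A` fixes the component along the rows, and `A(v - A⁺Av) = 0` by the first Penrose equation.
The formula also makes the projection jointly measurable in the vector and the rows. -/
theorem starProjection_rowSpan (A : ι → EuclideanSpace ℝ κ) (v : EuclideanSpace ℝ κ) :
    (rowSpan A).starProjection v =
      WithLp.toLp 2 (pinv (rowMatrix A) *ᵥ (rowMatrix A *ᵥ v.ofLp)) := by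
  have h := isMoorePenroseInverse_pinv (rowMatrix A)
  refine Submodule.eq_starProjection_of_mem_orthogonal (pinv_mulVec_mem A _) ?_
  rw [mem_orthogonal_rowSpan]
  refine congrFun ?_
  rw [← rowMatrix_mulVec, WithLp.ofLp_sub, Matrix.mulVec_sub, Matrix.mulVec_mulVec,
    Matrix.mulVec_mulVec, h.mul_mul_left, sub_self]
  rfl

theorem measurable_pinvCol (i : ι) :
    Measurable fun A : ι → EuclideanSpace ℝ κ => pinvCol A i := by
  have h1 : Measurable fun A : ι → EuclideanSpace ℝ κ => (fun i j => A i j : ι → κ → ℝ) := by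
    fun_prop
  have h2 := measurable_pinv.comp h1
  have h3 : Measurable fun A : ι → EuclideanSpace ℝ κ => fun j => pinv (rowMatrix A) j i :=
    measurable_pi_lambda _ fun j => (measurable_pi_apply i).comp ((measurable_pi_apply j).comp h2)
  exact (WithLp.measurable_toLp 2 _).comp h3

theorem measurable_pinvNormSq :
    Measurable fun A : ι → EuclideanSpace ℝ κ => pinvNormSq A :=
  Finset.measurable_sum _ fun i _ => (measurable_pinvCol i).norm.pow_const 2

theorem pinv_mulVec_eq_sum (A : ι → EuclideanSpace ℝ κ) (u : ι → ℝ) :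
    WithLp.toLp 2 (pinv (rowMatrix A) *ᵥ u) = ∑ i, u i • pinvCol A i := by
  ext j
  simp [Matrix.mulVec, dotProduct, pinvCol, mul_comm]

theorem measurable_starProjection_rowSpan :
    Measurable fun q : EuclideanSpace ℝ κ × (ι → EuclideanSpace ℝ κ) =>
      (rowSpan q.2).starProjection q.1 := by
  simp_rw [starProjection_rowSpan, pinv_mulVec_eq_sum, rowMatrix_mulVec]
  have h (i : ι) : Measurable fun q : EuclideanSpace ℝ κ × (ι → EuclideanSpace ℝ κ) =>
      ⟪q.2 i, q.1⟫ • pinvCol q.2 i := by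
    have h1 : Measurable fun q : EuclideanSpace ℝ κ × (ι → EuclideanSpace ℝ κ) =>
      pinvCol q.2 i := (measurable_pinvCol i).comp measurable_snd
    have h2 : Measurable fun q : EuclideanSpace ℝ κ × (ι → EuclideanSpace ℝ κ) =>
      ⟪q.2 i, q.1⟫ := by fun_prop
    exact h2.smul h1
  exact Finset.measurable_sum _ fun i _ => h i

theorem measurable_starProjection_orthogonal_rowSpan :
    Measurable fun q : EuclideanSpace ℝ κ × (ι → EuclideanSpace ℝ κ) =>
      (rowSpan q.2)ᗮ.starProjection q.1 := by
  have : (fun q : EuclideanSpace ℝ κ × (ι → EuclideanSpace ℝ κ) =>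
      (rowSpan q.2)ᗮ.starProjection q.1) = fun q => q.1 - (rowSpan q.2).starProjection q.1 := by
    funext q
    rw [Submodule.starProjection_orthogonal']
    rfl
  rw [this]
  exact measurable_fst.sub (measurable_starProjection_rowSpan (ι := ι) (κ := κ))

/-- The squared distance of a vector to the row span. -/
noncomputable def residSq (A : ι → EuclideanSpace ℝ κ) (v : EuclideanSpace ℝ κ) : ℝ :=
  ‖(rowSpan A)ᗮ.starProjection v‖ ^ 2

theorem measurable_residSq :
    Measurable fun q : EuclideanSpace ℝ κ × (ι → EuclideanSpace ℝ κ) => residSq q.2 q.1 := by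
  have h := measurable_starProjection_orthogonal_rowSpan (ι := ι) (κ := κ)
  have h2 := (continuous_norm (E := EuclideanSpace ℝ κ)).measurable.comp h
  exact h2.pow_const 2

theorem measurable_residSq_left (v : EuclideanSpace ℝ κ) :
    Measurable fun A : ι → EuclideanSpace ℝ κ => residSq A v := by
  have h : Measurable fun A : ι → EuclideanSpace ℝ κ => (v, A) := measurable_prodMk_left
  have h2 : Measurable ((fun q : EuclideanSpace ℝ κ × (ι → EuclideanSpace ℝ κ) =>
      residSq q.2 q.1) ∘ fun A : ι → EuclideanSpace ℝ κ => (v, A)) :=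
    (measurable_residSq (ι := ι) (κ := κ)).comp h
  exact h2

theorem residSq_nonneg (A : ι → EuclideanSpace ℝ κ) (v : EuclideanSpace ℝ κ) :
    0 ≤ residSq A v := sq_nonneg _

/-- The residual of the pseudo-inverse solution splits orthogonally. -/
theorem norm_sub_pinv_mulVec_sq (A : ι → EuclideanSpace ℝ κ) (v : EuclideanSpace ℝ κ)
    (u : ι → ℝ) :
    ‖v - WithLp.toLp 2 (pinv (rowMatrix A) *ᵥ (rowMatrix A *ᵥ v.ofLp + u))‖ ^ 2 =
      residSq A v + ‖∑ i, u i • pinvCol A i‖ ^ 2 := by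
  rw [Matrix.mulVec_add, WithLp.toLp_add, ← starProjection_rowSpan, ← sub_sub]
  have h1 : v - (rowSpan A).starProjection v = (rowSpan A)ᗮ.starProjection v := by
    rw [Submodule.starProjection_orthogonal']; rfl
  rw [h1, pinv_mulVec_eq_sum, residSq, sq, norm_sub_sq_eq_norm_sq_add_norm_sq_real, sq, sq]
  rw [real_inner_comm, ← pinv_mulVec_eq_sum]
  exact Submodule.starProjection_apply_mem (rowSpan A)ᗮ v _ (pinv_mulVec_mem A u)

theorem rowMatrix_mul_pinv_of_linearIndependent [DecidableEq ι] {A : ι → EuclideanSpace ℝ κ}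
    (hA : LinearIndependent ℝ A) : rowMatrix A * pinv (rowMatrix A) = 1 := by
  have h := isMoorePenroseInverse_pinv (rowMatrix A)
  have hr : LinearIndependent ℝ (rowMatrix A).row := by
    have := hA.map' (WithLp.linearEquiv 2 ℝ (κ → ℝ)).toLinearMap (LinearEquiv.ker _)
    exact this
  rw [← Matrix.vecMul_injective_iff] at hr
  have e : (rowMatrix A * pinv (rowMatrix A)) * rowMatrix A = (1 : Matrix ι ι ℝ) * rowMatrix A := by
    rw [h.mul_mul_left, Matrix.one_mul]
  ext i j
  refine congrFun (hr (a₁ := (rowMatrix A * pinv (rowMatrix A)) i)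
    (a₂ := (1 : Matrix ι ι ℝ) i) ?_) j
  exact congrFun e i

theorem inner_pinvCol_of_linearIndependent [DecidableEq ι] {A : ι → EuclideanSpace ℝ κ}
    (hA : LinearIndependent ℝ A) (i j : ι) : ⟪A i, pinvCol A j⟫ = if i = j then 1 else 0 := by
  have := congrFun (congrFun (rowMatrix_mul_pinv_of_linearIndependent hA) i) j
  rw [Matrix.one_apply] at this
  rw [← this]
  simp [Matrix.mul_apply, rowMatrix, pinvCol, PiLp.inner_apply, mul_comm]

/-- Zeroing row `j` instead of deleting it keeps the index type unchanged. -/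
theorem rowSpan_update_zero [DecidableEq ι] (A : ι → EuclideanSpace ℝ κ) (j : ι) :
    rowSpan (Function.update A j 0) = Submodule.span ℝ (A '' {i | i ≠ j}) := by
  apply le_antisymm
  · refine Submodule.span_le.2 ?_
    rintro _ ⟨i, rfl⟩
    by_cases h : i = j
    · subst h; simp
    · rw [Function.update_of_ne h]
      exact Submodule.subset_span ⟨i, h, rfl⟩
  · refine Submodule.span_mono ?_
    rintro _ ⟨i, h, rfl⟩
    exact ⟨i, Function.update_of_ne h _ _⟩

/-- Column `j` lies in the row span and is orthogonal to every row but `A j`. It is therefore a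
multiple of the part of `A j` orthogonal to the other rows, and `⟪A j, pinvCol A j⟫ = 1` fixes the
factor. -/
theorem norm_pinvCol_sq_mul_of_linearIndependent [DecidableEq ι] {A : ι → EuclideanSpace ℝ κ}
    (hA : LinearIndependent ℝ A) (j : ι) :
    ‖pinvCol A j‖ ^ 2 * residSq (Function.update A j 0) (A j) = 1 := by
  rw [residSq]
  set S := rowSpan (Function.update A j 0) with hS
  have hb : pinvCol A j ∈ Sᗮ := by
    rw [hS, mem_orthogonal_rowSpan]
    intro i
    by_cases h : i = j
    · subst h; simp
    · rw [Function.update_of_ne h, inner_pinvCol_of_linearIndependent hA, if_neg h]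
  have hspan : rowSpan A = Submodule.span ℝ {A j} ⊔ S := by
    rw [hS, rowSpan_update_zero, rowSpan, ← Submodule.span_union, ← Set.image_singleton,
      ← Set.image_union, ← Set.image_univ]
    congr 2
    ext i
    simp [em]
  have hm := pinvCol_mem A j
  rw [hspan, Submodule.mem_sup] at hm
  obtain ⟨y, hy, s, hs, hys⟩ := hm
  obtain ⟨c, rfl⟩ := Submodule.mem_span_singleton.1 hy
  have e : pinvCol A j = c • Sᗮ.starProjection (A j) := by
    have := Submodule.starProjection_eq_self_iff.2 hb
    have hs0 : Sᗮ.starProjection s = 0 := by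
      rw [Submodule.starProjection_orthogonal']
      simp [Submodule.starProjection_eq_self_iff.2 hs]
    rw [← this, ← hys, map_add, map_smul, hs0, add_zero]
  have h1 : ⟪A j, pinvCol A j⟫ = 1 := by simp [inner_pinvCol_of_linearIndependent hA]
  have h2 : ⟪A j, Sᗮ.starProjection (A j)⟫ = ‖Sᗮ.starProjection (A j)‖ ^ 2 := by
    rw [← real_inner_self_eq_norm_sq, Submodule.inner_starProjection_left_eq_right,
      Submodule.starProjection_eq_self_iff.2 (Submodule.starProjection_apply_mem _ _)]
  rw [e, real_inner_smul_right, h2] at h1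
  rw [e, norm_smul, Real.norm_eq_abs, mul_pow, sq_abs]
  calc _ = (c * ‖Sᗮ.starProjection (A j)‖ ^ 2) ^ 2 := by ring
    _ = 1 := by rw [h1, one_pow]

end Rows

/-! ### One-dimensional integrals behind the inverse chi-squared mean. -/

section GaussianIntegrals

open Real Set Filter Topology

/-- Both sides are `∞` at `r = 0`, so no null set has to be discarded when this represents an
inverse square. -/
theorem lintegral_exp_neg_mul_Ioi {r : ℝ} (hr : 0 ≤ r) :
    ∫⁻ t in Ioi (0 : ℝ), ENNReal.ofReal (exp (-(t * r))) = (ENNReal.ofReal r)⁻¹ := by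
  rcases hr.eq_or_lt with rfl | hr
  · simp
  have h1 : IntegrableOn (fun t : ℝ => exp (-(t * r))) (Ioi 0) := by
    have := integrableOn_exp_mul_Ioi (a := -r) (by linarith) 0
    refine this.congr_fun (fun t _ => ?_) measurableSet_Ioi
    simp only
    congr 1
    ring
  rw [← ofReal_integral_eq_lintegral_ofReal h1 (ae_of_all _ fun t => (exp_pos _).le),
    ← ENNReal.ofReal_inv_of_pos hr]
  congr 1
  have := integral_exp_mul_Ioi (a := -r) (by linarith) 0
  simp only [mul_zero, exp_zero] at this
  rw [inv_eq_one_div, ← neg_div_neg_eq, ← this]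
  refine setIntegral_congr_fun measurableSet_Ioi fun t _ => ?_
  congr 1
  ring

/-- The expected inverse of a chi-squared variable with `ν` degrees of freedom. -/
noncomputable def invChiSqMean (ν : ℕ) : ℝ≥0∞ :=
  if 3 ≤ ν then ENNReal.ofReal (1 / ((ν : ℝ) - 2)) else ∞

theorem lintegral_one_add_two_mul_rpow (ν : ℕ) :
    ∫⁻ t in Ioi (0 : ℝ), ENNReal.ofReal ((1 + 2 * t) ^ (-(ν : ℝ) / 2)) = invChiSqMean ν := by
  unfold invChiSqMean
  split_ifs with hν
  · have hν' : (3 : ℝ) ≤ ν := by exact_mod_cast hν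
    have hd : ∀ t ∈ Ici (0 : ℝ), HasDerivAt
        (fun t : ℝ => -(1 / ((ν : ℝ) - 2)) * (1 + 2 * t) ^ (-(ν : ℝ) / 2 + 1))
        ((1 + 2 * t) ^ (-(ν : ℝ) / 2)) t := by
      intro t ht
      have ht' : (0 : ℝ) ≤ t := ht
      have h1 : HasDerivAt (fun t : ℝ => 1 + 2 * t) 2 t := by
        simpa using ((hasDerivAt_id t).const_mul 2).const_add 1
      have h2 := (h1.rpow_const (p := -(ν : ℝ) / 2 + 1) (Or.inl (by linarith))).const_mul
        (-(1 / ((ν : ℝ) - 2)))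
      refine h2.congr_deriv ?_
      rw [add_sub_cancel_right]
      have : (ν : ℝ) - 2 ≠ 0 := by linarith
      field_simp
      ring
    have hlim : Tendsto (fun t : ℝ => -(1 / ((ν : ℝ) - 2)) * (1 + 2 * t) ^ (-(ν : ℝ) / 2 + 1))
        atTop (𝓝 0) := by
      have h1 : Tendsto (fun t : ℝ => 1 + 2 * t) atTop atTop :=
        tendsto_atTop_add_const_left _ _ (tendsto_id.const_mul_atTop two_pos)
      have h2 := (tendsto_rpow_neg_atTop (y := (ν : ℝ) / 2 - 1) (by linarith)).comp h1
      have h3 := h2.const_mul (-(1 / ((ν : ℝ) - 2)))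
      rw [mul_zero] at h3
      refine h3.congr fun t => ?_
      simp only [Function.comp]
      congr 2
      ring
    have hpos : ∀ t ∈ Ioi (0 : ℝ), 0 ≤ (1 + 2 * t) ^ (-(ν : ℝ) / 2) := fun t ht =>
      rpow_nonneg (by have : (0 : ℝ) < t := ht; linarith) _
    rw [← ofReal_integral_eq_lintegral_ofReal
      (integrableOn_Ioi_deriv_of_nonneg' hd hpos hlim)
      ((ae_restrict_iff' measurableSet_Ioi).2 (ae_of_all _ hpos)),
      integral_Ioi_of_hasDerivAt_of_nonneg' hd hpos hlim]
    simp
  · have hν' : (ν : ℝ) ≤ 2 := by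
      have : ν ≤ 2 := by omega
      exact_mod_cast this
    by_contra hne
    have hpos : ∀ t ∈ Ioi (1 : ℝ), 0 ≤ (1 + 2 * t) ^ (-(ν : ℝ) / 2) := fun t ht =>
      rpow_nonneg (by have : (1 : ℝ) < t := ht; linarith) _
    have hint : IntegrableOn (fun t : ℝ => (1 + 2 * t) ^ (-(ν : ℝ) / 2)) (Ioi 1) := by
      refine ⟨(by fun_prop : Measurable _).aestronglyMeasurable, ?_⟩
      rw [hasFiniteIntegral_iff_ofReal ((ae_restrict_iff' measurableSet_Ioi).2 (ae_of_all _ hpos))]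
      exact (lintegral_mono_set (Ioi_subset_Ioi zero_le_one)).trans_lt (lt_top_iff_ne_top.2 hne)
    -- For `t > 1` one has `1 + 2t ≤ 3t`, so `1/t ≤ 3(1 + 2t)⁻¹`, and `-1 ≤ -ν/2`. Convergence would
    -- make `1/t` integrable at infinity.
    have h3 : IntegrableOn (fun t : ℝ => 3 * (1 + 2 * t) ^ (-(ν : ℝ) / 2)) (Ioi 1) :=
      hint.const_mul 3
    have hinv : IntegrableOn (fun t : ℝ => t ^ (-1 : ℝ)) (Ioi 1) := by
      refine h3.mono' (by fun_prop : Measurable _).aestronglyMeasurable ?_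
      refine (ae_restrict_iff' measurableSet_Ioi).2 (ae_of_all _ fun t ht => ?_)
      have ht : (1 : ℝ) < t := ht
      rw [norm_of_nonneg (rpow_nonneg (by linarith) _)]
      have h4 : (1 + 2 * t) ^ (-1 : ℝ) ≤ (1 + 2 * t) ^ (-(ν : ℝ) / 2) :=
        rpow_le_rpow_of_exponent_le (by linarith) (by linarith)
      refine le_trans ?_ (mul_le_mul_of_nonneg_left h4 (by norm_num))
      rw [rpow_neg_one, rpow_neg_one, inv_eq_one_div, ← div_eq_mul_inv,
        div_le_div_iff₀ (by linarith) (by linarith)]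
      linarith
    rw [integrableOn_Ioi_rpow_iff one_pos] at hinv
    exact lt_irrefl _ hinv

theorem integral_exp_neg_mul_sq_gaussianReal {t : ℝ} (ht : 0 ≤ t) :
    ∫ z, exp (-(t * z ^ 2)) ∂gaussianReal 0 1 = (1 + 2 * t) ^ (-(1 : ℝ) / 2) := by
  rw [integral_gaussianReal_eq_integral_smul one_ne_zero]
  have e : ∀ z : ℝ, gaussianPDFReal 0 1 z • exp (-(t * z ^ 2)) =
      (√(2 * π))⁻¹ * exp (-(t + 1 / 2) * z ^ 2) := by
    intro z
    rw [gaussianPDFReal, smul_eq_mul, mul_assoc, ← exp_add, NNReal.coe_one, mul_one]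
    congr 2
    ring
  simp_rw [e]
  rw [integral_const_mul, integral_gaussian, ← sqrt_inv, ← sqrt_mul (by positivity), neg_div,
    rpow_neg (by linarith), ← sqrt_eq_rpow, ← sqrt_inv]
  congr 1
  have := pi_pos.ne'
  have : 1 + 2 * t ≠ 0 := by linarith
  have : t + 1 / 2 ≠ 0 := by linarith
  field_simp
  ring

end GaussianIntegrals

/-! ### Standard Gaussian vectors: projections, inverse square norm, null subspaces. -/

section StdGaussian

variable {E F : Type*} [NormedAddCommGroup E] [InnerProductSpace ℝ E] [FiniteDimensional ℝ E]
  [MeasurableSpace E] [BorelSpace E] [NormedAddCommGroup F] [InnerProductSpace ℝ F]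
  [FiniteDimensional ℝ F] [MeasurableSpace F] [BorelSpace F]

theorem lintegral_exp_neg_mul_norm_sq_stdGaussian {t : ℝ} (ht : 0 ≤ t) :
    ∫⁻ z, ENNReal.ofReal (Real.exp (-(t * ‖z‖ ^ 2))) ∂stdGaussian F =
      ENNReal.ofReal ((1 + 2 * t) ^ (-(Module.finrank ℝ F : ℝ) / 2)) := by
  have hint : Integrable (fun z : F => Real.exp (-(t * ‖z‖ ^ 2))) (stdGaussian F) := by
    refine Integrable.of_bound (by fun_prop : Measurable _).aestronglyMeasurable 1
      (ae_of_all _ fun z => ?_)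
    rw [Real.norm_of_nonneg (Real.exp_pos _).le, Real.exp_le_one_iff]
    have := mul_nonneg ht (sq_nonneg ‖z‖)
    linarith
  rw [← ofReal_integral_eq_lintegral_ofReal hint (ae_of_all _ fun z => (Real.exp_pos _).le)]
  congr 1
  rw [stdGaussian, integral_map (Measurable.aemeasurable (by fun_prop))
    (by fun_prop : Measurable _).aestronglyMeasurable]
  have e : ∀ x : Fin (Module.finrank ℝ F) → ℝ,
      Real.exp (-(t * ‖∑ i, x i • stdOrthonormalBasis ℝ F i‖ ^ 2)) =
      ∏ i, Real.exp (-(t * (x i) ^ 2)) := by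
    intro x
    rw [← Real.exp_sum, ← real_inner_self_eq_norm_sq,
      (stdOrthonormalBasis ℝ F).orthonormal.inner_sum]
    simp [Finset.mul_sum, sq]
  simp_rw [e]
  rw [integral_fintype_prod_eq_prod (f := fun _ z => Real.exp (-(t * z ^ 2)))]
  simp_rw [integral_exp_neg_mul_sq_gaussianReal ht]
  rw [Finset.prod_const, Finset.card_univ, Fintype.card_fin, ← Real.rpow_natCast,
    ← Real.rpow_mul (by linarith)]
  congr 1
  ring

/-- Write `1/r` as the integral of `exp(-tr)` over `t > 0`, exchange by Tonelli, and insert the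
Laplace transform `(1 + 2t)^(-ν/2)` of `‖z‖²`. -/
theorem lintegral_inv_norm_sq_stdGaussian :
    ∫⁻ z, (ENNReal.ofReal (‖z‖ ^ 2))⁻¹ ∂stdGaussian F = invChiSqMean (Module.finrank ℝ F) := by
  simp_rw [← lintegral_exp_neg_mul_Ioi (sq_nonneg _)]
  rw [lintegral_lintegral_swap (by fun_prop : Measurable _).aemeasurable,
    ← lintegral_one_add_two_mul_rpow]
  refine setLIntegral_congr_fun measurableSet_Ioi fun t ht => ?_
  exact lintegral_exp_neg_mul_norm_sq_stdGaussian (le_of_lt ht)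

/-- The image has at `t` the characteristic function of the source at the adjoint of `t`, and this
depends only on the norm. -/
theorem stdGaussian_map_of_norm_adjoint (f : E →L[ℝ] F)
    (hf : ∀ t, ‖ContinuousLinearMap.adjoint f t‖ = ‖t‖) :
    (stdGaussian E).map f = stdGaussian F := by
  have : IsProbabilityMeasure ((stdGaussian E).map f) :=
    Measure.isProbabilityMeasure_map f.measurable.aemeasurable
  apply Measure.ext_of_charFun
  funext t
  rw [charFun_stdGaussian, charFun_apply, integral_map f.measurable.aemeasurable
    (Measurable.aestronglyMeasurable (by fun_prop))]
  simp_rw [← ContinuousLinearMap.adjoint_inner_right]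
  rw [← charFun_apply, charFun_stdGaussian, hf]

theorem stdGaussian_map_orthogonalProjectionOnto (W : Submodule ℝ E) :
    (stdGaussian E).map W.orthogonalProjectionOnto = stdGaussian W := by
  apply stdGaussian_map_of_norm_adjoint
  intro t
  rw [Submodule.adjoint_orthogonalProjectionOnto]
  rfl

theorem lintegral_inv_norm_starProjection_sq (W : Submodule ℝ E) :
    ∫⁻ z, (ENNReal.ofReal (‖W.starProjection z‖ ^ 2))⁻¹ ∂stdGaussian E =
      invChiSqMean (Module.finrank ℝ W) := by
  rw [← lintegral_inv_norm_sq_stdGaussian, ← stdGaussian_map_orthogonalProjectionOnto,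
    lintegral_map (by fun_prop) (by fun_prop)]
  rfl

theorem stdGaussian_map_inner (v : E) :
    (stdGaussian E).map (fun z => ⟪v, z⟫) = gaussianReal 0 (‖v‖ ^ 2).toNNReal := by
  have := IsGaussian.map_eq_gaussianReal (μ := stdGaussian E) (innerSL ℝ v)
  rw [integral_strongDual_stdGaussian, variance_dual_stdGaussian, innerSL_apply_norm] at this
  exact this

/-- A proper subspace lies in a hyperplane, and the coordinate along its normal is a nondegenerate
Gaussian, hence atomless. -/
theorem stdGaussian_submodule_eq_zero {W : Submodule ℝ E} (hW : W ≠ ⊤) :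
    stdGaussian E W = 0 := by
  have : Wᗮ ≠ ⊥ := by rwa [Ne, Submodule.orthogonal_eq_bot_iff]
  obtain ⟨v, hv, hv0⟩ := Submodule.exists_mem_ne_zero_of_ne_bot this
  have hsub : (W : Set E) ⊆ (fun z => ⟪v, z⟫) ⁻¹' {0} := fun z hz =>
    Submodule.inner_left_of_mem_orthogonal hz hv
  refine measure_mono_null hsub ?_
  rw [← Measure.map_apply (by fun_prop) (measurableSet_singleton 0), stdGaussian_map_inner]
  have : (‖v‖ ^ 2).toNNReal ≠ 0 := by
    have : 0 < ‖v‖ ^ 2 := by positivity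
    simpa [Real.toNNReal_eq_zero] using hv0
  have := nullSingletonClass_gaussianReal (μ := 0) this
  exact measure_singleton 0

end StdGaussian

/-! ### Resampling one coordinate of a product measure. -/

theorem measurePreserving_update {ι α : Type*} [Fintype ι] [DecidableEq ι] [MeasurableSpace α]
    (μ : Measure α) [IsProbabilityMeasure μ] (j : ι) :
    MeasurePreserving (fun q : (ι → α) × α => Function.update q.1 j q.2)
      ((Measure.pi fun _ => μ).prod μ) (Measure.pi fun _ => μ) := by
  have hm : Measurable fun q : (ι → α) × α => Function.update q.1 j q.2 := by
    refine measurable_pi_lambda _ fun i => ?_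
    by_cases h : i = j
    · subst h; simpa using measurable_snd
    · simp only [Function.update_of_ne h]
      fun_prop
  refine ⟨hm, (Measure.pi_eq fun s hs => ?_).symm⟩
  rw [Measure.map_apply hm (.univ_pi hs)]
  have : (fun q : (ι → α) × α => Function.update q.1 j q.2) ⁻¹' Set.univ.pi s =
      (Set.univ.pi (Function.update s j Set.univ)) ×ˢ s j := by
    ext q
    simp only [Set.mem_preimage, Set.mem_pi, Set.mem_univ, true_imp_iff, Set.mem_prod]
    constructor
    · intro h
      refine ⟨fun i => ?_, by simpa using h j⟩
      by_cases hij : i = j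
      · subst hij; simp
      · simpa [hij] using h i
    · rintro ⟨h1, h2⟩ i
      by_cases hij : i = j
      · subst hij; simpa using h2
      · simpa [hij] using h1 i
  rw [this, Measure.prod_prod, Measure.pi_pi, ← Finset.prod_erase_mul _ _ (Finset.mem_univ j),
    ← Finset.prod_erase_mul _ (fun i => μ (s i)) (Finset.mem_univ j)]
  simp only [Function.update_self, measure_univ, mul_one]
  congr 1
  refine Finset.prod_congr rfl fun i hi => ?_
  rw [Function.update_of_ne (Finset.ne_of_mem_erase hi)]

theorem measurable_update_const {ι α : Type*} [DecidableEq ι] [MeasurableSpace α]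
    (a : α) (j : ι) :
    Measurable fun q : (ι → α) × α => (q.2, Function.update q.1 j a) := by
  refine measurable_snd.prodMk (measurable_pi_lambda _ fun i => ?_)
  by_cases h : i = j
  · subst h; simp
  · simp only [Function.update_of_ne h]
    fun_prop

/-- Independence of `A j` from the other coordinates: overwriting entry `j` by the constant `a`
hides it from the second argument of `f`. -/
theorem lintegral_pi_resample {ι α : Type*} [Fintype ι] [DecidableEq ι] [MeasurableSpace α]
    (μ : Measure α) [IsProbabilityMeasure μ] (j : ι) (a : α) {f : α × (ι → α) → ℝ≥0∞}
    (hf : Measurable f) :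
    ∫⁻ A, f (A j, Function.update A j a) ∂(Measure.pi fun _ => μ) =
      ∫⁻ A, ∫⁻ r, f (r, Function.update A j a) ∂μ ∂(Measure.pi fun _ => μ) := by
  have h1 : Measurable fun A : ι → α => f (A j, Function.update A j a) :=
    hf.comp ((measurable_update_const a j).comp (measurable_id.prodMk (measurable_pi_apply j)))
  rw [← (measurePreserving_update μ j).lintegral_comp h1]
  simp only [Function.update_self, Function.update_idem]
  exact lintegral_prod _ (hf.comp (measurable_update_const a j)).aemeasurable

/-- The law of independent standard Gaussian rows. -/
noncomputable abbrev gaussianRows (ι κ : Type*) [Fintype ι] [Fintype κ] :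
    Measure (ι → EuclideanSpace ℝ κ) :=
  Measure.pi fun _ => stdGaussian (EuclideanSpace ℝ κ)

/-! ### Expected residual and expected pseudo-inverse norm of a Gaussian matrix. -/

section Rows

variable {ι κ : Type*} [Fintype ι] [Fintype κ]

theorem finrank_rowSpan_update_zero_lt [DecidableEq ι] (A : ι → EuclideanSpace ℝ κ) (j : ι) :
    Module.finrank ℝ (rowSpan (Function.update A j 0)) < Fintype.card ι := by
  have e : rowSpan (Function.update A j 0) =
      Submodule.span ℝ (Set.range fun i : {i // i ≠ j} => A i) := by
    rw [rowSpan_update_zero]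
    congr 1
    ext v
    simp
  rw [e]
  refine (finrank_range_le_card _).trans_lt ?_
  exact Fintype.card_subtype_lt (x := j) (by simp)

theorem finrank_rowSpan_update_zero [DecidableEq ι] {A : ι → EuclideanSpace ℝ κ}
    (hA : LinearIndependent ℝ A) (j : ι) :
    Module.finrank ℝ (rowSpan (Function.update A j 0)) + 1 = Fintype.card ι := by
  have e : rowSpan (Function.update A j 0) =
      Submodule.span ℝ (Set.range fun i : {i // i ≠ j} => A i) := by
    rw [rowSpan_update_zero]
    congr 1
    ext v
    simp
  have hli : LinearIndependent ℝ fun i : {i // i ≠ j} => A i :=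
    hA.comp _ Subtype.val_injective
  rw [e, finrank_span_eq_card hli, Fintype.card_subtype_compl, Fintype.card_subtype_eq]
  have : 0 < Fintype.card ι := Fintype.card_pos_iff.2 ⟨j⟩
  omega

/-- The other rows span a proper subspace, by dimension, and an independent Gaussian row almost
surely avoids it. -/
theorem ae_linearIndependent_gaussianRows (h : Fintype.card ι ≤ Fintype.card κ) :
    ∀ᵐ A ∂gaussianRows ι κ, LinearIndependent ℝ A := by
  classical
  simp_rw [linearIndependent_iff_notMem_span]
  rw [ae_all_iff]
  intro j
  set M : Set (EuclideanSpace ℝ κ × (ι → EuclideanSpace ℝ κ)) :=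
    {q | q.1 ∈ rowSpan q.2} with hM
  have hMm : MeasurableSet M := by
    simp_rw [hM, ← Submodule.starProjection_eq_self_iff]
    exact measurableSet_eq_fun measurable_starProjection_rowSpan measurable_fst
  have hN := measurable_update_const (0 : EuclideanSpace ℝ κ) j hMm
  have key : (gaussianRows ι κ).prod (stdGaussian (EuclideanSpace ℝ κ))
      ((fun q => (q.2, Function.update q.1 j 0)) ⁻¹' M) = 0 := by
    rw [Measure.measure_prod_null hN]
    refine ae_of_all _ fun A => ?_
    refine stdGaussian_submodule_eq_zero (W := rowSpan (Function.update A j 0)) fun htop => ?_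
    have h1 := finrank_rowSpan_update_zero_lt A j
    rw [htop, finrank_top, finrank_euclideanSpace] at h1
    omega
  have hset : MeasurableSet {A : ι → EuclideanSpace ℝ κ |
      (A j, Function.update A j 0) ∈ M} := by
    refine (?_ : Measurable fun A : ι → EuclideanSpace ℝ κ => (A j, Function.update A j 0)) hMm
    exact (measurable_update_const 0 j).comp (measurable_id.prodMk (measurable_pi_apply j))
  rw [ae_iff]
  have e1 : {A : ι → EuclideanSpace ℝ κ | ¬ A j ∉ Submodule.span ℝ (A '' (Set.univ \ {j}))} =
      {A | (A j, Function.update A j 0) ∈ M} := by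
    ext A
    have : (Set.univ \ {j} : Set ι) = {i | i ≠ j} := by ext i; simp
    simp only [not_not, Set.mem_ofPred_eq, hM, rowSpan_update_zero, this]
  rw [e1, ← (measurePreserving_update (stdGaussian (EuclideanSpace ℝ κ)) j).measure_preimage
    hset.nullMeasurableSet]
  convert! key using 2
  ext q
  simp

theorem lintegral_pinvNormSq (h : Fintype.card ι ≤ Fintype.card κ) :
    ∫⁻ A, ENNReal.ofReal (pinvNormSq A) ∂gaussianRows ι κ =
      Fintype.card ι * invChiSqMean (Fintype.card κ + 1 - Fintype.card ι) := by
  classical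
  have hli := ae_linearIndependent_gaussianRows h
  simp_rw [pinvNormSq, ENNReal.ofReal_sum_of_nonneg fun i _ => sq_nonneg _]
  rw [lintegral_finsetSum _ fun i _ =>
    ((measurable_pinvCol i).norm.pow_const 2).ennreal_ofReal]
  have hsum (c : ℝ≥0∞) : Fintype.card ι * c = ∑ _j : ι, c := by simp
  rw [hsum]
  refine Finset.sum_congr rfl fun j _ => ?_
  have hf : Measurable fun q : EuclideanSpace ℝ κ × (ι → EuclideanSpace ℝ κ) =>
      (ENNReal.ofReal (residSq q.2 q.1))⁻¹ :=
    measurable_residSq.ennreal_ofReal.inv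
  change ∫⁻ A, ENNReal.ofReal (‖pinvCol A j‖ ^ 2) ∂gaussianRows ι κ = _
  have e1 : ∀ᵐ A ∂gaussianRows ι κ, ENNReal.ofReal (‖pinvCol A j‖ ^ 2) =
      (ENNReal.ofReal (residSq (Function.update A j 0) (A j)))⁻¹ := by
    filter_upwards [hli] with A hA
    have := norm_pinvCol_sq_mul_of_linearIndependent hA j
    refine ENNReal.eq_inv_of_mul_eq_one_left ?_
    rw [← ENNReal.ofReal_mul (sq_nonneg _), this, ENNReal.ofReal_one]
  rw [lintegral_congr_ae e1]
  refine (lintegral_pi_resample (stdGaussian (EuclideanSpace ℝ κ)) j 0 hf).trans ?_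
  -- With the other rows fixed, the residual is a standard Gaussian vector on their orthogonal
  -- complement, of dimension `card κ - (card ι - 1)`.
  have e2 : ∀ᵐ A ∂gaussianRows ι κ, ∫⁻ r, (ENNReal.ofReal
      (residSq (Function.update A j 0) r))⁻¹
        ∂stdGaussian (EuclideanSpace ℝ κ) =
      invChiSqMean (Fintype.card κ + 1 - Fintype.card ι) := by
    filter_upwards [hli] with A hA
    simp_rw [residSq]
    rw [lintegral_inv_norm_starProjection_sq]
    congr 1
    have h1 := finrank_rowSpan_update_zero hA j
    have h2 := (rowSpan (Function.update A j 0)).finrank_add_finrank_orthogonal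
    rw [finrank_euclideanSpace] at h2
    omega
  rw [lintegral_congr_ae e2, lintegral_const, measure_univ, mul_one]

/-- The sum is the trace of the projection, which equals its rank. -/
theorem sum_norm_starProjection_sq {E : Type*} [NormedAddCommGroup E] [InnerProductSpace ℝ E]
    [FiniteDimensional ℝ E] (b : OrthonormalBasis κ ℝ E) (W : Submodule ℝ E) :
    ∑ i, ‖W.starProjection (b i)‖ ^ 2 = Module.finrank ℝ W := by
  have hp : LinearMap.IsProj W (W.starProjection : E →ₗ[ℝ] E) :=
    ⟨fun x => Submodule.starProjection_apply_mem _ _,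
      fun x hx => Submodule.starProjection_eq_self_iff.2 hx⟩
  rw [← hp.trace, LinearMap.trace_eq_sum_inner _ b]
  refine Finset.sum_congr rfl fun i _ => ?_
  rw [← real_inner_self_eq_norm_sq, Submodule.inner_starProjection_left_eq_right,
    Submodule.starProjection_eq_self_iff.2 (Submodule.starProjection_apply_mem _ _)]
  rfl

theorem rowSpan_comp_isometry (f : EuclideanSpace ℝ κ ≃ₗᵢ[ℝ] EuclideanSpace ℝ κ)
    (A : ι → EuclideanSpace ℝ κ) :
    rowSpan (fun i => f (A i)) = (rowSpan A).map f.toLinearEquiv.toLinearMap := by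
  rw [rowSpan, rowSpan, Submodule.map_span, ← Set.range_comp]
  rfl

theorem residSq_comp_isometry
    (f : EuclideanSpace ℝ κ ≃ₗᵢ[ℝ] EuclideanSpace ℝ κ)
    (A : ι → EuclideanSpace ℝ κ) (v : EuclideanSpace ℝ κ) :
    residSq (fun i => f (A i)) (f v) = residSq A v := by
  unfold residSq
  have e : (rowSpan fun i => f (A i)).starProjection (f v) =
      f ((rowSpan A).starProjection v) := by
    simp_rw [rowSpan_comp_isometry]
    rw [Submodule.starProjection_map_apply, f.symm_apply_apply]
  rw [Submodule.starProjection_orthogonal', Submodule.starProjection_orthogonal']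
  change ‖f v - (rowSpan fun i => f (A i)).starProjection (f v)‖ ^ 2 =
    ‖v - (rowSpan A).starProjection v‖ ^ 2
  rw [e, ← map_sub, f.norm_map]

theorem lintegral_residSq_congr {v w : EuclideanSpace ℝ κ}
    (h : ‖v‖ = ‖w‖) :
    ∫⁻ A, ENNReal.ofReal (residSq A v) ∂gaussianRows ι κ =
      ∫⁻ A, ENNReal.ofReal (residSq A w) ∂gaussianRows ι κ := by
  obtain ⟨f, hf⟩ : ∃ f : EuclideanSpace ℝ κ ≃ₗᵢ[ℝ] EuclideanSpace ℝ κ, f v = w :=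
    -- The reflection exchanging two vectors of equal norm.
    ⟨_, Submodule.reflection_sub h⟩
  have hrow : MeasurePreserving f (stdGaussian (EuclideanSpace ℝ κ))
      (stdGaussian (EuclideanSpace ℝ κ)) := ⟨f.continuous.measurable, stdGaussian_map f⟩
  have hmp : MeasurePreserving (fun (A : ι → EuclideanSpace ℝ κ) i => f (A i))
      (gaussianRows ι κ) (gaussianRows ι κ) :=
    measurePreserving_pi _ _ fun _ => hrow
  rw [← hmp.lintegral_comp (measurable_residSq_left w).ennreal_ofReal, ← hf]
  simp_rw [residSq_comp_isometry]

/-- By rotation invariance all unit vectors have the same mean residual. Over an orthonormal basis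
the residuals sum to the dimension of the orthogonal complement of the row span. The product form
avoids dividing in `ℝ≥0∞`. -/
theorem card_mul_lintegral_residSq
    (h : Fintype.card ι ≤ Fintype.card κ) (w : EuclideanSpace ℝ κ) :
    Fintype.card κ *
      ∫⁻ A, ENNReal.ofReal (residSq A w) ∂gaussianRows ι κ =
      ENNReal.ofReal (‖w‖ ^ 2) * (Fintype.card κ - Fintype.card ι : ℕ) := by
  classical
  set b := EuclideanSpace.basisFun κ ℝ
  have hw : ∀ i, ∫⁻ A, ENNReal.ofReal (residSq A w) ∂gaussianRows ι κ =
      ENNReal.ofReal (‖w‖ ^ 2) *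
        ∫⁻ A, ENNReal.ofReal (residSq A (b i)) ∂gaussianRows ι κ := by
    intro i
    rw [← lintegral_const_mul _ (measurable_residSq_left (b i)).ennreal_ofReal,
      lintegral_residSq_congr (w := ‖w‖ • b i)
        (by rw [norm_smul, b.norm_eq_one, mul_one, norm_norm])]
    refine lintegral_congr fun A => ?_
    rw [residSq, residSq, map_smul, norm_smul, mul_pow, norm_norm, ENNReal.ofReal_mul (sq_nonneg _)]
  rw [← nsmul_eq_mul, ← Finset.card_univ (α := κ), ← Finset.sum_const,
    Finset.sum_congr rfl fun i _ => hw i, ← Finset.mul_sum,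
    ← lintegral_finsetSum _ fun i _ => (measurable_residSq_left (b i)).ennreal_ofReal]
  congr 1
  simp_rw [← ENNReal.ofReal_sum_of_nonneg fun i _ => residSq_nonneg _ _, residSq,
    sum_norm_starProjection_sq]
  have e : ∀ᵐ A ∂gaussianRows ι κ,
      ENNReal.ofReal (Module.finrank ℝ (rowSpan A)ᗮ) = (Fintype.card κ - Fintype.card ι : ℕ) := by
    filter_upwards [ae_linearIndependent_gaussianRows h] with A hA
    have h1 : Module.finrank ℝ (rowSpan A) = Fintype.card ι := finrank_span_eq_card hA
    have h2 := (rowSpan A).finrank_add_finrank_orthogonal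
    rw [finrank_euclideanSpace] at h2
    rw [ENNReal.ofReal_natCast]
    congr 1
    omega
  rw [lintegral_congr_ae e, lintegral_const, measure_univ, mul_one, Finset.card_univ]

/-- The columns of the matrix with the given rows. -/
noncomputable def colVec (A : ι → EuclideanSpace ℝ κ) (j : κ) : EuclideanSpace ℝ ι :=
  WithLp.toLp 2 fun i => A i j

theorem rowMatrix_colVec (A : ι → EuclideanSpace ℝ κ) :
    rowMatrix (colVec A) = (rowMatrix A)ᵀ := rfl

theorem pinvNormSq_colVec (A : ι → EuclideanSpace ℝ κ) :
    pinvNormSq (colVec A) = pinvNormSq A := by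
  simp only [pinvNormSq, pinvCol, EuclideanSpace.real_norm_sq_eq, rowMatrix_colVec, pinv_transpose,
    Matrix.transpose_apply]
  exact Finset.sum_comm

/-- Uncurry to the product over `ι × κ`, swap the factors of the index, and curry again. -/
theorem pi_pi_map_swap {α : Type*} [MeasurableSpace α] (μ : Measure α) [IsProbabilityMeasure μ] :
    (Measure.pi fun _ : ι => Measure.pi fun _ : κ => μ).map (fun A j i => A i j) =
      Measure.pi fun _ : κ => Measure.pi fun _ : ι => μ := by
  have h1 := Measure.infinitePi_map_curry_symm (fun (_ : ι) (_ : κ) => μ)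
  have h2 := Measure.infinitePi_map_curry (fun (_ : κ) (_ : ι) => μ)
  simp only [Measure.infinitePi_eq_pi] at h1 h2
  have h3 := (measurePreserving_piCongrLeft (fun _ : κ × ι => μ) (Equiv.prodComm ι κ)).map_eq
  rw [← h2, ← h3, ← h1, Measure.map_map (by fun_prop) (by fun_prop),
    Measure.map_map (by fun_prop) (by fun_prop)]
  rfl

theorem gaussianRows_eq_map :
    gaussianRows ι κ =
      (Measure.pi fun _ : ι => Measure.pi fun _ : κ => gaussianReal 0 1).map
        (fun A i => WithLp.toLp 2 (A i)) := by
  have (_ : ι) : IsProbabilityMeasure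
      ((Measure.pi fun _ : κ => gaussianReal 0 1).map (WithLp.toLp 2)) := by
    rw [map_pi_eq_stdGaussian]
    infer_instance
  have h := Measure.pi_map_pi (ι := ι) (μ := fun _ => Measure.pi fun _ : κ => gaussianReal 0 1)
    (f := fun _ => WithLp.toLp 2) fun _ => (WithLp.measurable_toLp 2 _).aemeasurable
  rw [h]
  simp_rw [map_pi_eq_stdGaussian]

theorem measurePreserving_colVec :
    MeasurePreserving (colVec : (ι → EuclideanSpace ℝ κ) → κ → EuclideanSpace ℝ ι)
      (gaussianRows ι κ) (gaussianRows κ ι) := by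
  have hm : Measurable (colVec : (ι → EuclideanSpace ℝ κ) → κ → EuclideanSpace ℝ ι) := by
    unfold colVec
    fun_prop
  refine ⟨hm, ?_⟩
  rw [gaussianRows_eq_map, gaussianRows_eq_map, ← pi_pi_map_swap, Measure.map_map hm (by fun_prop),
    Measure.map_map (by fun_prop) (by fun_prop)]
  rfl

theorem lintegral_pinvNormSq_of_card_le (h : Fintype.card κ ≤ Fintype.card ι) :
    ∫⁻ A, ENNReal.ofReal (pinvNormSq A) ∂gaussianRows ι κ =
      Fintype.card κ * invChiSqMean (Fintype.card ι + 1 - Fintype.card κ) := by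
  rw [← lintegral_pinvNormSq h,
    ← (measurePreserving_colVec (ι := ι) (κ := κ)).lintegral_comp
      measurable_pinvNormSq.ennreal_ofReal]
  simp_rw [pinvNormSq_colVec]

/-- The columns are almost surely independent, so `A⁺A = 1` and the rows span the whole space. -/
theorem ae_residSq_eq_zero (h : Fintype.card κ ≤ Fintype.card ι)
    (w : EuclideanSpace ℝ κ) :
    ∀ᵐ A ∂gaussianRows ι κ, residSq A w = 0 := by
  classical
  filter_upwards [(measurePreserving_colVec (ι := ι) (κ := κ)).quasiMeasurePreserving.ae
    (ae_linearIndependent_gaussianRows h)] with A hA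
  have h1 := rowMatrix_mul_pinv_of_linearIndependent hA
  rw [rowMatrix_colVec, pinv_transpose, ← Matrix.transpose_mul, Matrix.transpose_eq_one] at h1
  rw [residSq, Submodule.starProjection_orthogonal']
  change ‖w - (rowSpan A).starProjection w‖ ^ 2 = 0
  rw [starProjection_rowSpan, Matrix.mulVec_mulVec, h1, Matrix.one_mulVec]
  simp

end Rows

open scoped NNReal

/-! ### Independence of the retained coordinates and the effective noise. -/

section LinearModel

variable {E F : Type*} [NormedAddCommGroup E] [InnerProductSpace ℝ E] [FiniteDimensional ℝ E]
  [MeasurableSpace E] [BorelSpace E] [NormedAddCommGroup F] [InnerProductSpace ℝ F]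
  [FiniteDimensional ℝ F] [MeasurableSpace F] [BorelSpace F]

/-- As `L v = 0`, the vector `v` is orthogonal to the range of the adjoint of `L`. The cross term in
`‖z‖²` below vanishes and the joint characteristic function factors. -/
theorem map_prod_linearModel (L : E →L[ℝ] F)
    (hL : ∀ t, ‖ContinuousLinearMap.adjoint L t‖ = ‖t‖) {v : E} (hv : L v = 0) {σ : ℝ} {s : ℝ≥0}
    (hs : (s : ℝ) = ‖v‖ ^ 2 + σ ^ 2) :
    ((stdGaussian E).prod (gaussianReal 0 1)).map (fun q => (L q.1, ⟪q.1, v⟫ + σ * q.2)) =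
      (stdGaussian F).prod (gaussianReal 0 s) := by
  have hm : Measurable fun q : E × ℝ => (L q.1, ⟪q.1, v⟫ + σ * q.2) := by fun_prop
  have := Measure.isProbabilityMeasure_map (μ := (stdGaussian E).prod (gaussianReal 0 1))
    hm.aemeasurable
  rw [← charFun_eq_prod_iff]
  intro t
  obtain ⟨a, r⟩ := t
  rw [charFun_apply, integral_map (by fun_prop) (Measurable.aestronglyMeasurable (by fun_prop)),
    integral_map hm.aemeasurable (Measurable.aestronglyMeasurable (by fun_prop))]
  set z : E := ContinuousLinearMap.adjoint L a + r • v with hz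
  have e : ∀ q : E × ℝ, Complex.exp (((⟪(WithLp.toLp 2 (L q.1, ⟪q.1, v⟫ + σ * q.2)
      : WithLp 2 (F × ℝ)), WithLp.toLp 2 (a, r)⟫ : ℝ) : ℂ) * Complex.I) =
      Complex.exp (((⟪q.1, z⟫ : ℝ) : ℂ) * Complex.I) *
        Complex.exp (((⟪q.2, r * σ⟫ : ℝ) : ℂ) * Complex.I) := by
    intro q
    rw [← Complex.exp_add, ← add_mul, ← Complex.ofReal_add]
    congr 3
    rw [hz, inner_add_right, ContinuousLinearMap.adjoint_inner_right, real_inner_smul_right]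
    simp only [WithLp.prod_inner_apply, RCLike.inner_apply, conj_trivial]
    ring
  simp_rw [e]
  rw [integral_prod_mul (fun x => Complex.exp (((⟪x, z⟫ : ℝ) : ℂ) * Complex.I))
    (fun y => Complex.exp (((⟪y, r * σ⟫ : ℝ) : ℂ) * Complex.I)), ← charFun_apply, ← charFun_apply,
    charFun_stdGaussian, charFun_stdGaussian, charFun_gaussianReal, charFun_gaussianReal,
    ← Complex.exp_add, ← Complex.exp_add]
  congr 1
  have hz2 : ‖z‖ ^ 2 = ‖a‖ ^ 2 + r ^ 2 * ‖v‖ ^ 2 := by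
    rw [hz, norm_add_sq_real, real_inner_smul_right, ContinuousLinearMap.adjoint_inner_left, hv,
      hL, norm_smul, mul_pow, Real.norm_eq_abs, sq_abs]
    simp
  have hs' : ((s : ℝ) : ℂ) = ((‖v‖ ^ 2 + σ ^ 2 : ℝ) : ℂ) := by rw [hs]
  have hz' : ((‖z‖ : ℝ) : ℂ) ^ 2 = ((‖a‖ ^ 2 + r ^ 2 * ‖v‖ ^ 2 : ℝ) : ℂ) := by
    rw [← hz2]; push_cast; rfl
  rw [hz', hs']
  push_cast
  ring

theorem lintegral_sq_gaussianReal (s : ℝ≥0) :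
    ∫⁻ z, ENNReal.ofReal (z ^ 2) ∂gaussianReal 0 s = s := by
  have h2 : MemLp id 2 (gaussianReal 0 s) := memLp_id_gaussianReal 2
  have h3 := variance_of_integral_eq_zero (X := id) (μ := gaussianReal 0 s) aemeasurable_id
    integral_id_gaussianReal
  rw [variance_id_gaussianReal] at h3
  simp only [id] at h3
  have h4 : Integrable (fun z : ℝ => z ^ 2) (gaussianReal 0 s) := h2.integrable_sq
  rw [← ofReal_integral_eq_lintegral_ofReal h4 (ae_of_all _ fun z => sq_nonneg z)]
  rw [← h3, ENNReal.ofReal_coe_nnreal]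

theorem lintegral_sq_linearModel (v : E) (σ : ℝ) :
    ∫⁻ q, ENNReal.ofReal ((⟪q.1, v⟫ + σ * q.2) ^ 2)
      ∂((stdGaussian E).prod (gaussianReal 0 1)) = ENNReal.ofReal (‖v‖ ^ 2 + σ ^ 2) := by
  set s : ℝ≥0 := (‖v‖ ^ 2 + σ ^ 2).toNNReal with hs
  have hs' : (s : ℝ) = ‖v‖ ^ 2 + σ ^ 2 := Real.coe_toNNReal _ (by positivity)
  -- Only the law of the second component is needed, so the retained space is taken to be trivial.
  have h := map_prod_linearModel (F := (⊥ : Submodule ℝ E)) 0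
    (fun t => by simp [Subsingleton.elim t 0]) (v := v) rfl hs'
  rw [← hs', ENNReal.ofReal_coe_nnreal, ← lintegral_sq_gaussianReal s]
  have h2 := (measurePreserving_snd (μ := stdGaussian (⊥ : Submodule ℝ E))
    (ν := gaussianReal 0 s)).lintegral_comp (f := fun z => ENNReal.ofReal (z ^ 2)) (by fun_prop)
  rw [← h2, ← h, lintegral_map (by fun_prop) (by fun_prop)]

end LinearModel

/-! ### Second moments of linear combinations of the noise. -/

section Noise

variable {ι κ : Type*} [Fintype ι] [Fintype κ]

theorem lintegral_sq_sum_gaussianReal (s : ℝ≥0) (c : ι → ℝ) :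
    ∫⁻ η, ENNReal.ofReal ((∑ i, η i * c i) ^ 2) ∂(Measure.pi fun _ : ι => gaussianReal 0 s) =
      ENNReal.ofReal (s * ∑ i, c i ^ 2) := by
  have hX (i : ι) : MemLp (fun z : ℝ => z * c i) 2 (gaussianReal 0 s) :=
    (memLp_id_gaussianReal 2).mul_const (c i)
  have hXi (i : ι) : MemLp (fun η : ι → ℝ => η i * c i) 2
      (Measure.pi fun _ : ι => gaussianReal 0 s) :=
    (hX i).comp_measurePreserving (measurePreserving_eval _ i)
  have hsum : MemLp (fun η : ι → ℝ => ∑ i, η i * c i) 2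
      (Measure.pi fun _ : ι => gaussianReal 0 s) := memLp_finsetSum _ fun i _ => hXi i
  have hmean : ∫ η, ∑ i, η i * c i ∂(Measure.pi fun _ : ι => gaussianReal 0 s) = 0 := by
    rw [integral_finsetSum _ fun i _ => (hXi i).integrable one_le_two]
    refine Finset.sum_eq_zero fun i _ => ?_
    rw [integral_mul_const]
    have := integral_comp_eval (μ := fun _ : ι => gaussianReal 0 s) (i := i) (f := fun z : ℝ => z)
      (by fun_prop)
    rw [this, integral_id_gaussianReal, zero_mul]
  have hvar := variance_sum_pi (μ := fun _ : ι => gaussianReal 0 s) hX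
  have e : (∑ i, fun η : ι → ℝ => η i * c i) = fun η => ∑ i, η i * c i := by
    ext η; simp
  rw [e, variance_of_integral_eq_zero hsum.aestronglyMeasurable.aemeasurable hmean] at hvar
  rw [← ofReal_integral_eq_lintegral_ofReal hsum.integrable_sq
    (ae_of_all _ fun η => sq_nonneg _), hvar]
  simp_rw [variance_mul_const, variance_fun_id_gaussianReal]
  rw [Finset.mul_sum]

theorem lintegral_norm_sq_sum_gaussianReal (s : ℝ≥0) (b : ι → EuclideanSpace ℝ κ) :
    ∫⁻ η, ENNReal.ofReal (‖∑ i, η i • b i‖ ^ 2) ∂(Measure.pi fun _ : ι => gaussianReal 0 s) =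
      ENNReal.ofReal (s * ∑ i, ‖b i‖ ^ 2) := by
  simp_rw [EuclideanSpace.real_norm_sq_eq, WithLp.ofLp_sum, Finset.sum_apply, PiLp.smul_apply,
    smul_eq_mul, ENNReal.ofReal_sum_of_nonneg fun i _ => sq_nonneg _]
  rw [lintegral_finsetSum _ fun k _ => by fun_prop]
  simp_rw [lintegral_sq_sum_gaussianReal]
  rw [Finset.sum_comm, Finset.mul_sum, ENNReal.ofReal_sum_of_nonneg]
  exact fun i _ => mul_nonneg s.2 (Finset.sum_nonneg fun i _ => sq_nonneg _)

end Noise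

/-! ### Splitting vectors into the coordinates in `T` and outside `T`. -/

section Split

variable {d : ℕ} (T : Finset (Fin d))

theorem inner_eq_subVector_add (x z : EuclideanSpace ℝ (Fin d)) :
    ⟪x, z⟫ = ⟪subVector x T, subVector z T⟫ + ⟪subVector x Tᶜ, subVector z Tᶜ⟫ := by
  simp only [PiLp.inner_apply, subVector]
  rw [← Finset.sum_add_sum_compl T, ← Finset.sum_coe_sort T, ← Finset.sum_coe_sort Tᶜ]

theorem subVector_rearrange (u : EuclideanSpace ℝ T)
    (v : EuclideanSpace ℝ (Tᶜ : Finset (Fin d))) : subVector (rearrange T u v) T = u := by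
  ext j
  simp [subVector, rearrange]

theorem subVector_compl_rearrange (u : EuclideanSpace ℝ T)
    (v : EuclideanSpace ℝ (Tᶜ : Finset (Fin d))) : subVector (rearrange T u v) Tᶜ = v := by
  ext j
  simp [subVector, rearrange, Finset.mem_compl.1 j.2]

theorem norm_sq_eq_subVector_add (x : EuclideanSpace ℝ (Fin d)) :
    ‖x‖ ^ 2 = ‖subVector x T‖ ^ 2 + ‖subVector x Tᶜ‖ ^ 2 := by
  simp_rw [← real_inner_self_eq_norm_sq]
  exact inner_eq_subVector_add T x x

/-- The restriction of a vector to the coordinates in `T`, as a linear map. -/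
noncomputable def restrictL : EuclideanSpace ℝ (Fin d) →L[ℝ] EuclideanSpace ℝ T :=
  LinearMap.toContinuousLinearMap
    { toFun := fun x => subVector x T
      map_add' := fun _ _ => rfl
      map_smul' := fun _ _ => rfl }

theorem restrictL_apply (x : EuclideanSpace ℝ (Fin d)) : restrictL T x = subVector x T := rfl

theorem norm_adjoint_restrictL (t : EuclideanSpace ℝ T) :
    ‖ContinuousLinearMap.adjoint (restrictL T) t‖ = ‖t‖ := by
  -- The adjoint of restriction is extension by zero.
  have e : ContinuousLinearMap.adjoint (restrictL T) t = rearrange T t 0 := by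
    refine ext_inner_right ℝ fun x => ?_
    rw [ContinuousLinearMap.adjoint_inner_left, inner_eq_subVector_add T, subVector_rearrange,
      subVector_compl_rearrange, inner_zero_left, add_zero, restrictL_apply]
  have h := norm_sq_eq_subVector_add T (rearrange T t 0)
  rw [subVector_rearrange, subVector_compl_rearrange, norm_zero] at h
  rw [e, ← sq_eq_sq₀ (norm_nonneg _) (norm_nonneg _), h]
  simp

theorem measurable_subVector (T : Finset (Fin d)) :
    Measurable fun x : EuclideanSpace ℝ (Fin d) => subVector x T :=
  (restrictL T).measurable

/-- The centred noise seen by the regression on the coordinates in `T`. -/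
theorem map_subVector_noise (w : EuclideanSpace ℝ (Fin d)) {σ : ℝ} {s : ℝ≥0}
    (hs : (s : ℝ) = ‖subVector w Tᶜ‖ ^ 2 + σ ^ 2) :
    ((stdGaussian (EuclideanSpace ℝ (Fin d))).prod (gaussianReal 0 1)).map
      (fun q => (subVector q.1 T,
        ⟪q.1, w⟫ + σ * q.2 - ⟪subVector q.1 T, subVector w T⟫)) =
      (stdGaussian (EuclideanSpace ℝ T)).prod (gaussianReal 0 s) := by
  -- Deleting the coordinates of `w` in `T` gives a vector killed by the restriction; its inner
  -- product with `x` is the omitted signal.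
  set v := rearrange T 0 (subVector w Tᶜ) with hv
  have h1 : ‖v‖ ^ 2 = ‖subVector w Tᶜ‖ ^ 2 := by
    rw [norm_sq_eq_subVector_add T, hv, subVector_rearrange, subVector_compl_rearrange]
    simp
  rw [← map_prod_linearModel (restrictL T) (norm_adjoint_restrictL T) (v := v) (σ := σ)
    (by rw [restrictL_apply, hv, subVector_rearrange]) (by rw [hs, h1])]
  congr 1
  funext q
  rw [restrictL_apply, inner_eq_subVector_add T q.1 w, inner_eq_subVector_add T q.1 v, hv,
    subVector_rearrange, subVector_compl_rearrange, inner_zero_right]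
  congr 1
  ring

theorem measurable_estimator {n : ℕ} :
    Measurable fun q : (Fin n → EuclideanSpace ℝ (Fin d)) × (Fin n → ℝ) =>
      estimator T q.1 q.2 := by
  have h0 : Measurable fun u : EuclideanSpace ℝ T => rearrange T u 0 := by
    unfold rearrange
    refine (WithLp.measurable_toLp 2 _).comp (measurable_pi_lambda _ fun j => ?_)
    by_cases h : j ∈ T <;> simp only [h, dif_pos, dif_neg, not_false_eq_true] <;> fun_prop
  have h1 : (fun q : (Fin n → EuclideanSpace ℝ (Fin d)) × (Fin n → ℝ) => estimator T q.1 q.2) =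
      fun q => rearrange T (∑ i, q.2 i • pinvCol (fun i => subVector (q.1 i) T) i) 0 := by
    funext q
    rw [← pinv_mulVec_eq_sum]
    rfl
  rw [h1]
  refine h0.comp (Finset.measurable_sum _ fun i _ => ?_)
  have h2 : Measurable fun q : (Fin n → EuclideanSpace ℝ (Fin d)) × (Fin n → ℝ) =>
      fun i => subVector (q.1 i) T :=
    measurable_pi_lambda _ fun i =>
      (measurable_subVector T).comp ((measurable_pi_apply i).comp measurable_fst)
  have h3 : Measurable fun q : (Fin n → EuclideanSpace ℝ (Fin d)) × (Fin n → ℝ) =>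
      pinvCol (fun i => subVector (q.1 i) T) i := (measurable_pinvCol i).comp h2
  have h4 : Measurable fun q : (Fin n → EuclideanSpace ℝ (Fin d)) × (Fin n → ℝ) => q.2 i := by
    fun_prop
  exact h4.smul h3

theorem norm_sub_estimator_sq {n : ℕ} (w : EuclideanSpace ℝ (Fin d))
    (X : Fin n → EuclideanSpace ℝ (Fin d)) (Y : Fin n → ℝ) :
    ‖w - estimator T X Y‖ ^ 2 = residSq (fun i => subVector (X i) T) (subVector w T) +
      ‖∑ i, (Y i - ⟪subVector (X i) T, subVector w T⟫) •
        pinvCol (fun i => subVector (X i) T) i‖ ^ 2 + ‖subVector w Tᶜ‖ ^ 2 := by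
  -- The residual `Y - A w_p` plays the role of the noise `u`, so that `A w_p + u` is `Y` again.
  rw [norm_sq_eq_subVector_add T, ← norm_sub_pinv_mulVec_sq]
  have e1 : subVector (w - estimator T X Y) T = subVector w T - subVector (estimator T X Y) T := rfl
  have e2 : subVector (w - estimator T X Y) Tᶜ =
    subVector w Tᶜ - subVector (estimator T X Y) Tᶜ := rfl
  rw [e1, e2, estimator, subVector_rearrange, subVector_compl_rearrange, sub_zero,
    rowMatrix_mulVec]
  congr 6
  funext i
  simp

end Split

open scoped NNReal

/-! ### The risk as an integral over Gaussian rows and independent noise. -/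

section Risk

variable {n d : ℕ} (T : Finset (Fin d)) (w : EuclideanSpace ℝ (Fin d)) (σ : ℝ)

/-- The law of an observation `(x, y)` in the Gaussian linear model. -/
noncomputable def observationLaw : Measure (EuclideanSpace ℝ (Fin d) × ℝ) :=
  ((stdGaussian (EuclideanSpace ℝ (Fin d))).prod (gaussianReal 0 1)).map
    fun q => (q.1, ⟪q.1, w⟫ + σ * q.2)

theorem measurable_observation :
    Measurable fun q : EuclideanSpace ℝ (Fin d) × ℝ => (q.1, ⟪q.1, w⟫ + σ * q.2) := by
  fun_prop

instance : IsProbabilityMeasure (observationLaw w σ) :=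
  Measure.isProbabilityMeasure_map (measurable_observation w σ).aemeasurable

theorem lintegral_test_error (v : EuclideanSpace ℝ (Fin d)) :
    ∫⁻ z, ENNReal.ofReal ((z.2 - ⟪z.1, v⟫) ^ 2) ∂observationLaw w σ =
      ENNReal.ofReal (‖w - v‖ ^ 2 + σ ^ 2) := by
  rw [observationLaw, lintegral_map (by fun_prop) (measurable_observation w σ),
    ← lintegral_sq_linearModel]
  refine lintegral_congr fun q => ?_
  rw [inner_sub_right]
  congr 2
  ring

theorem map_residual_observationLaw {s : ℝ≥0}
    (hs : (s : ℝ) = ‖subVector w Tᶜ‖ ^ 2 + σ ^ 2) :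
    (observationLaw w σ).map
      (fun z => (subVector z.1 T, z.2 - ⟪subVector z.1 T, subVector w T⟫)) =
      (stdGaussian (EuclideanSpace ℝ T)).prod (gaussianReal 0 s) := by
  have hm := measurable_subVector T
  rw [observationLaw, Measure.map_map (by fun_prop) (measurable_observation w σ),
    ← map_subVector_noise T w hs]
  rfl

theorem measurable_test_error :
    Measurable fun q : (Fin n → EuclideanSpace ℝ (Fin d) × ℝ) × (EuclideanSpace ℝ (Fin d) × ℝ) =>
      ENNReal.ofReal ((q.2.2 - ⟪q.2.1,
        estimator T (fun i => (q.1 i).1) (fun i => (q.1 i).2)⟫) ^ 2) := by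
  let f := fun q : (Fin n → EuclideanSpace ℝ (Fin d) × ℝ) × (EuclideanSpace ℝ (Fin d) × ℝ) =>
    ((fun i => (q.1 i).1 : Fin n → EuclideanSpace ℝ (Fin d)), fun i => (q.1 i).2)
  have hf : Measurable f := by fun_prop
  have h2 : Measurable ((fun q : (Fin n → EuclideanSpace ℝ (Fin d)) × (Fin n → ℝ) =>
      estimator T q.1 q.2) ∘ f) := (measurable_estimator T).comp hf
  have h3 : Measurable fun q : (Fin n → EuclideanSpace ℝ (Fin d) × ℝ) ×
      (EuclideanSpace ℝ (Fin d) × ℝ) =>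
      estimator T (fun i => (q.1 i).1) (fun i => (q.1 i).2) := h2
  fun_prop

/-- Regressing the sample on the coordinates in `T` splits it into independent Gaussian rows and
independent Gaussian noise. -/
theorem measurePreserving_sample {s : ℝ≥0}
    (hs : (s : ℝ) = ‖subVector w Tᶜ‖ ^ 2 + σ ^ 2) :
    MeasurePreserving (fun D : Fin n → EuclideanSpace ℝ (Fin d) × ℝ =>
        ((fun i => subVector (D i).1 T : Fin n → EuclideanSpace ℝ T),
          fun i => (D i).2 - ⟪subVector (D i).1 T, subVector w T⟫))
      (Measure.pi fun _ => observationLaw w σ)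
      ((gaussianRows (Fin n) T).prod (Measure.pi fun _ => gaussianReal 0 s)) := by
  have hm := measurable_subVector T
  have h1 : MeasurePreserving
      (fun z : EuclideanSpace ℝ (Fin d) × ℝ =>
        (subVector z.1 T, z.2 - ⟪subVector z.1 T, subVector w T⟫))
      (observationLaw w σ) ((stdGaussian (EuclideanSpace ℝ T)).prod (gaussianReal 0 s)) :=
    ⟨by fun_prop, map_residual_observationLaw T w σ hs⟩
  have h2 := measurePreserving_pi (ι := Fin n) _ _ fun _ => h1
  exact (measurePreserving_arrowProdEquivProdArrow _ _ (Fin n)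
    (fun _ => stdGaussian (EuclideanSpace ℝ T)) fun _ => gaussianReal 0 s).comp h2

/-- Bias, variance and irreducible error: given the rows, integrating out the noise turns `‖A⁺η‖²`
into `s` times the squared Frobenius norm of `A⁺`. -/
theorem lintegral_estimation_error {s : ℝ≥0}
    (hs : (s : ℝ) = ‖subVector w Tᶜ‖ ^ 2 + σ ^ 2) :
    ∫⁻ D : Fin n → EuclideanSpace ℝ (Fin d) × ℝ,
      ENNReal.ofReal (‖w - estimator T (fun i => (D i).1) (fun i => (D i).2)‖ ^ 2 + σ ^ 2)
        ∂(Measure.pi fun _ => observationLaw w σ) =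
      ∫⁻ A, ENNReal.ofReal (residSq A (subVector w T)) ∂gaussianRows (Fin n) T +
        s * ∫⁻ A, ENNReal.ofReal (pinvNormSq A) ∂gaussianRows (Fin n) T + s := by
  set u := subVector w T
  have hsum : Measurable fun q : (Fin n → EuclideanSpace ℝ T) × (Fin n → ℝ) =>
      ∑ i, q.2 i • pinvCol q.1 i := by
    refine Finset.measurable_sum _ fun i _ => ?_
    have h3 : Measurable fun q : (Fin n → EuclideanSpace ℝ T) × (Fin n → ℝ) =>
      pinvCol q.1 i := (measurable_pinvCol i).comp measurable_fst
    have h4 : Measurable fun q : (Fin n → EuclideanSpace ℝ T) × (Fin n → ℝ) => q.2 i := by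
      fun_prop
    exact h4.smul h3
  have hr : Measurable fun q : (Fin n → EuclideanSpace ℝ T) × (Fin n → ℝ) =>
      ENNReal.ofReal (residSq q.1 u) :=
    (measurable_residSq_left u).ennreal_ofReal.comp measurable_fst
  have hF : Measurable fun q : (Fin n → EuclideanSpace ℝ T) × (Fin n → ℝ) =>
      ENNReal.ofReal (residSq q.1 u) +
        ENNReal.ofReal (‖∑ i, q.2 i • pinvCol q.1 i‖ ^ 2) + s :=
    (hr.add (hsum.norm.pow_const 2).ennreal_ofReal).add_const _
  have e : ∀ D : Fin n → EuclideanSpace ℝ (Fin d) × ℝ,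
      ENNReal.ofReal (‖w - estimator T (fun i => (D i).1) (fun i => (D i).2)‖ ^ 2 + σ ^ 2) =
      ENNReal.ofReal (residSq (fun i => subVector (D i).1 T) u) +
        ENNReal.ofReal (‖∑ i, ((D i).2 - ⟪subVector (D i).1 T, u⟫) •
          pinvCol (fun i => subVector (D i).1 T) i‖ ^ 2) + s := by
    intro D
    rw [norm_sub_estimator_sq, add_assoc, ← hs, ENNReal.ofReal_add
      (add_nonneg (residSq_nonneg _ _) (sq_nonneg _)) s.coe_nonneg, ENNReal.ofReal_add (residSq_nonneg _ _)
      (sq_nonneg _), ENNReal.ofReal_coe_nnreal]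
  rw [lintegral_congr e]
  refine ((measurePreserving_sample (n := n) T w σ hs).lintegral_comp hF).trans ?_
  rw [lintegral_prod _ hF.aemeasurable]
  have e2 : ∀ A : Fin n → EuclideanSpace ℝ T,
      ∫⁻ η, (ENNReal.ofReal (residSq A u) + ENNReal.ofReal (‖∑ i, η i • pinvCol A i‖ ^ 2) + s)
        ∂(Measure.pi fun _ : Fin n => gaussianReal 0 s) =
      ENNReal.ofReal (residSq A u) + s * ENNReal.ofReal (pinvNormSq A) + s := by
    intro A
    rw [lintegral_add_right _ measurable_const, lintegral_add_left measurable_const,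
      lintegral_const, lintegral_const, measure_univ, mul_one, mul_one,
      lintegral_norm_sq_sum_gaussianReal, ENNReal.ofReal_mul s.coe_nonneg, ENNReal.ofReal_coe_nnreal]
    rfl
  rw [lintegral_congr e2, lintegral_add_right _ measurable_const,
    lintegral_add_left (measurable_residSq_left u).ennreal_ofReal,
    lintegral_const_mul _ measurable_pinvNormSq.ennreal_ofReal, lintegral_const, measure_univ,
    mul_one]

theorem pi_option_map {ι α : Type*} [Fintype ι] [MeasurableSpace α] (μ : Measure α)
    [IsProbabilityMeasure μ] :
    (Measure.pi fun _ : Option ι => μ).map (fun z => ((fun i => z (some i)), z none)) =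
      (Measure.pi fun _ : ι => μ).prod μ := by
  rw [← Measure.pi_map_piOptionEquivProd (fun _ : Option ι => μ),
    Measure.map_map (by fun_prop) (MeasurableEquiv.measurable _)]
  exact Measure.map_id

/-- Joint independence over `Option (Fin n)`, with `none` as the test point, makes the joint law a
product, which allows integrating over the test point first. -/
theorem map_sample_test {Ω : Type*} [MeasurableSpace Ω] {P : Measure Ω} [IsProbabilityMeasure P]
    {x : Ω → EuclideanSpace ℝ (Fin d)} {ε y : Ω → ℝ} (hx : Measurable x) (hε : Measurable ε)
    (hx_law : P.map x = stdGaussian (EuclideanSpace ℝ (Fin d)))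
    (hε_law : P.map ε = gaussianReal 0 1) (hxε : IndepFun x ε P)
    (hy : ∀ ω, y ω = ⟪x ω, w⟫ + σ * ε ω)
    {X : Fin n → Ω → EuclideanSpace ℝ (Fin d)} {Y : Fin n → Ω → ℝ}
    (hX : ∀ i, Measurable (X i)) (hY : ∀ i, Measurable (Y i))
    (h_copy : ∀ i, IdentDistrib (fun ω => (X i ω, Y i ω)) (fun ω => (x ω, y ω)) P P)
    (h_indep : iIndepFun (fun (o : Option (Fin n)) (ω : Ω) =>
      o.elim (x ω, y ω) (fun i => (X i ω, Y i ω))) P) :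
    P.map (fun ω => ((fun i => (X i ω, Y i ω)), (x ω, y ω))) =
      (Measure.pi fun _ : Fin n => observationLaw w σ).prod (observationLaw w σ) := by
  have hym : Measurable y := by
    have : y = fun ω => ⟪x ω, w⟫ + σ * ε ω := funext hy
    rw [this]
    fun_prop
  have hlaw : P.map (fun ω => (x ω, y ω)) = observationLaw w σ := by
    rw [observationLaw, ← hx_law, ← hε_law,
      ← (indepFun_iff_map_prod_eq_prod_map_map hx.aemeasurable hε.aemeasurable).1 hxε,
      Measure.map_map (measurable_observation w σ) (by fun_prop)]
    congr 1
    funext ω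
    rw [hy]
    rfl
  have hm (o : Option (Fin n)) : Measurable fun ω =>
      o.elim (x ω, y ω) (fun i => (X i ω, Y i ω)) := by
    cases o with
    | none => exact hx.prodMk hym
    | some i => exact (hX i).prodMk (hY i)
  have hj := h_indep.map_fun_eq_pi_map fun o => (hm o).aemeasurable
  have ho (o : Option (Fin n)) : P.map (fun ω => o.elim (x ω, y ω) (fun i => (X i ω, Y i ω))) =
      observationLaw w σ := by
    cases o with
    | none => exact hlaw
    | some i => exact (h_copy i).map_eq.trans hlaw
  simp_rw [ho] at hj
  rw [← pi_option_map, ← hj, Measure.map_map (by fun_prop) (measurable_pi_lambda _ hm)]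
  rfl

end Risk

end DoubleDescent

/-! ### Assembly of the three regimes. -/

theorem mainTheorem1
    {Ω : Type*} [MeasurableSpace Ω] (P : Measure Ω) [IsProbabilityMeasure P]
    (n d p : ℕ) (hn : 1 ≤ n) (hp : 1 ≤ p)
    (w : EuclideanSpace ℝ (Fin d)) (σ : ℝ) (hσ : 0 < σ)
    -- the test point `(x, y)`, with `y = xᵀ w + σ ε`
    (x : Ω → EuclideanSpace ℝ (Fin d)) (ε y : Ω → ℝ)
    (hx : Measurable x) (hε : Measurable ε)
    (hx_law : P.map x = stdGaussian (EuclideanSpace ℝ (Fin d)))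
    (hε_law : P.map ε = gaussianReal 0 1)
    (hxε : IndepFun x ε P)
    (hy : ∀ ω, y ω = ⟪x ω, w⟫ + σ * ε ω)
    -- the training sample: `n` i.i.d. copies of `(x, y)`, independent of the test point
    (X : Fin n → Ω → EuclideanSpace ℝ (Fin d)) (Y : Fin n → Ω → ℝ)
    (hX : ∀ i, Measurable (X i)) (hY : ∀ i, Measurable (Y i))
    (h_copy : ∀ i, IdentDistrib (fun ω => (X i ω, Y i ω)) (fun ω => (x ω, y ω)) P P)
    (h_indep : iIndepFun
      (fun (o : Option (Fin n)) (ω : Ω) =>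
        o.elim (x ω, y ω) (fun i => (X i ω, Y i ω))) P)
    -- the selected coordinates
    (T : Finset (Fin d)) (hT : T.card = p)
    -- the risk, as an expectation in `[0, ∞]`
    (risk : ℝ≥0∞)
    (h_risk : risk = ∫⁻ ω, ENNReal.ofReal
      ((y ω - ⟪x ω, DoubleDescent.estimator T (fun i => X i ω) (fun i => Y i ω)⟫) ^ 2) ∂P) :
    (p + 2 ≤ n → risk = ENNReal.ofReal
      ((‖DoubleDescent.subVector w Tᶜ‖ ^ 2 + σ ^ 2) * (1 + (p : ℝ) / ((n : ℝ) - p - 1)))) ∧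
    (n ≤ p + 1 ∧ p ≤ n + 1 → risk = ∞) ∧
    (n + 2 ≤ p → risk = ENNReal.ofReal
      (‖DoubleDescent.subVector w T‖ ^ 2 * (1 - (n : ℝ) / p) +
        (‖DoubleDescent.subVector w Tᶜ‖ ^ 2 + σ ^ 2) * (1 + (n : ℝ) / ((p : ℝ) - n - 1)))) := by
  open DoubleDescent in
  set s : NNReal := (‖subVector w Tᶜ‖ ^ 2 + σ ^ 2).toNNReal with hs_def
  have hs : (s : ℝ) = ‖subVector w Tᶜ‖ ^ 2 + σ ^ 2 := Real.coe_toNNReal _ (by positivity)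
  have hs0 : (s : ℝ≥0∞) ≠ 0 := by
    have : (0 : ℝ) < s := by rw [hs]; positivity
    exact_mod_cast this.ne'
  have hym : Measurable y := by
    have : y = fun ω => ⟪x ω, w⟫ + σ * ε ω := funext hy
    rw [this]
    fun_prop
  have hrisk : risk =
      ∫⁻ A, ENNReal.ofReal (residSq A (subVector w T)) ∂gaussianRows (Fin n) T +
        s * ∫⁻ A, ENNReal.ofReal (pinvNormSq A) ∂gaussianRows (Fin n) T + s := by
    rw [← lintegral_estimation_error T w σ hs, h_risk]
    simp_rw [← lintegral_test_error]
    rw [← lintegral_prod _ (measurable_test_error T).aemeasurable, ← map_sample_test w σ hx hε hx_law hε_law hxε hy hX hY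
      h_copy h_indep, lintegral_map (measurable_test_error T) (by fun_prop)]
  have hcn : Fintype.card (Fin n) = n := Fintype.card_fin n
  have hcp : Fintype.card T = p := by rw [Fintype.card_coe, hT]
  refine ⟨fun h => ?_, fun h => ?_, fun h => ?_⟩
  · have h0 : ∫⁻ A, ENNReal.ofReal (residSq A (subVector w T)) ∂gaussianRows (Fin n) T = 0 := by
      rw [lintegral_congr_ae (g := fun _ => 0), lintegral_zero]
      filter_upwards [ae_residSq_eq_zero (ι := Fin n) (κ := T) (by omega) (subVector w T)]
        with A hA
      rw [hA, ENNReal.ofReal_zero]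
    rw [hrisk, h0, lintegral_pinvNormSq_of_card_le (by omega), hcn, hcp, invChiSqMean,
      if_pos (by omega), zero_add, ← hs, ← ENNReal.ofReal_coe_nnreal, ← ENNReal.ofReal_natCast,
      ← ENNReal.ofReal_mul (by positivity), ← ENNReal.ofReal_mul s.coe_nonneg]
    -- The number of degrees of freedom is a truncated difference, which is harmless here because `p
    -- ≤ n + 1`.
    have h2 : ((n + 1 - p : ℕ) : ℝ) - 2 = (n : ℝ) - p - 1 := by
      rw [Nat.cast_sub (by omega)]
      push_cast
      ring
    have h3 : (0 : ℝ) < (n : ℝ) - p - 1 := by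
      have : ((p + 2 : ℕ) : ℝ) ≤ n := by exact_mod_cast h
      push_cast at this
      linarith
    rw [h2, ← ENNReal.ofReal_add (by positivity) s.coe_nonneg]
    congr 1
    ring
  · have h0 : ∫⁻ A, ENNReal.ofReal (pinvNormSq A) ∂gaussianRows (Fin n) T = ∞ := by
      -- On either side there are at most two degrees of freedom, so the inverse chi-squared mean is
      -- infinite. Its factor `n` or `p` is nonzero, and so is `s`.
      rcases le_total n p with hnp | hnp
      · rw [lintegral_pinvNormSq (by omega), hcn, hcp, invChiSqMean, if_neg (by omega)]
        exact ENNReal.mul_top (by exact_mod_cast (by omega : n ≠ 0))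
      · rw [lintegral_pinvNormSq_of_card_le (by omega), hcn, hcp, invChiSqMean,
          if_neg (by omega)]
        exact ENNReal.mul_top (by exact_mod_cast (by omega : p ≠ 0))
    rw [hrisk, h0, ENNReal.mul_top hs0, add_top, top_add]
  · have hp0 : (0 : ℝ) < p := by exact_mod_cast hp
    have h0 : ∫⁻ A, ENNReal.ofReal (residSq A (subVector w T)) ∂gaussianRows (Fin n) T =
        ENNReal.ofReal (‖subVector w T‖ ^ 2 * (1 - (n : ℝ) / p)) := by
      have h1 := card_mul_lintegral_residSq (ι := Fin n) (κ := T) (by omega) (subVector w T)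
      rw [hcn, hcp] at h1
      have hp1 : (p : ℝ≥0∞) ≠ 0 := by exact_mod_cast (by omega : p ≠ 0)
      -- Cancelling the finite nonzero factor `p` turns `p · E = ‖w_p‖² (p - n)` into the stated
      -- value.
      rw [← ENNReal.mul_right_inj hp1 (ENNReal.natCast_ne_top p), h1, ← ENNReal.ofReal_natCast,
        ← ENNReal.ofReal_natCast, ← ENNReal.ofReal_mul (by positivity),
        ← ENNReal.ofReal_mul (by positivity), Nat.cast_sub (by omega)]
      congr 1
      field_simp
    have h2 : ((p + 1 - n : ℕ) : ℝ) - 2 = (p : ℝ) - n - 1 := by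
      rw [Nat.cast_sub (by omega)]
      push_cast
      ring
    have h3 : (0 : ℝ) < (p : ℝ) - n - 1 := by
      have : ((n + 2 : ℕ) : ℝ) ≤ p := by exact_mod_cast h
      push_cast at this
      linarith
    have h4 : 0 ≤ 1 - (n : ℝ) / p := by
      rw [sub_nonneg, div_le_one hp0]
      linarith
    rw [hrisk, h0, lintegral_pinvNormSq (by omega), hcn, hcp, invChiSqMean, if_pos (by omega), h2,
      ← hs, ← ENNReal.ofReal_coe_nnreal, ← ENNReal.ofReal_natCast,
      ← ENNReal.ofReal_mul (by positivity), ← ENNReal.ofReal_mul s.coe_nonneg,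
      ← ENNReal.ofReal_add (by positivity) (by positivity),
      ← ENNReal.ofReal_add (by positivity) s.coe_nonneg]
    congr 1
    ring
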